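/- Let $d$ be an odd positive integer, $\ell=\sqrt{2\pi/d}$, $\omega=e^{2\pi i/d}$, and let $\hat\rho$ be a density operator (a positive operator of trace $1$) on $L^2(\mathbb R)$. Let $\hat D(x,p)=e^{i(p\hat x-x\hat p)}$, i.e. $(\hat D(x,p)\psi)(y)=e^{ip(y-x/2)}\psi(y-x)$. **Zak–Gross Wigner function.** On the torus $\mathbb T^2_{d\ell}=[0,d\ell)^2$ put $$W_{\hat\rho}(u,v)=\frac1{2\pi}\sum_{m,n\in\mathbb Z}(-1)^{mn}e^{i\ell(nv-mu)}\,\mathrm{Tr}[\hat D(n\ell,m\ell)\hat\rho],$$ read as the Fourier series of an integrable function $W_{\hat\rho}$ (defined almost everywhere). Its negative volume is $\mathcal N_{\hat\rho}=\int_{\mathbb T^2_{d\ell}}\frac1d\,|W_{\hat\rho}(u,v)|\,du\,dv$. **Gross Wigner function.** On $\mathbb C^d$ with basis $|j\rangle$, $j\in\mathbb Z_d$, let $\hat X|j\rangle=|j+1\rangle$, $\hat Z|j\rangle=\omega^j|j\rangle$, $\hat D_d(a,b)=\omega^{2^{-1}ab}\hat X^a\hat Z^b$ with $2^{-1}=\frac{d+1}2$,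 and $\hat\Pi_d|j\rangle=|-j\rangle$. For a $d\times d$ matrix $M$ put $W^{\mathrm{DV}}_M(a,b)=\mathrm{Tr}[\hat D_d(a,b)\hat\Pi_d\hat D_d(a,b)^\dagger M]$ and $\mathcal N^{\mathrm{DV}}_M=\frac1d\sum_{a,b\in\mathbb Z_d}|W^{\mathrm{DV}}_M(a,b)|$. **Error correction.** Let $|\bar j\rangle=\ell^{-1/2}\sum_{n\in\mathbb Z}|j\ell+nd\ell\rangle_{\hat x}$, $j=0,\dots,d-1$, be the (ideal) code words of the square Gottesman–Kitaev–Preskill code, and let $\hat P_{(s,t)}=\sum_{j}\hat D(s,t)|\bar j\rangle\langle\bar j|\hat D(s,t)^\dagger$ for $(s,t)\in\mathbb T^2_\ell=[0,\ell)^2$. For $\psi\in L^2(\mathbb R)$ the amplitude $\langle\bar j|\hat D(s,t)^\dagger|\psi\rangle=\ell^{-1/2}\sum_{n}(\hat D(s,t)^\dagger\psi)(j\ell+nd\ell)$ is a series converging in $L^2(\mathbb T^2_\ell)$ as a function of $(s,t)$. By writing $\hat\rho$ as a sum of rank-one operators, it defines for almost every $(s,t)$ the sub-normalised logical state $\underline\rho(s,t)$,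 the $d\times d$ matrix with entries $\langle\bar j|\hat D(s,t)^\dagger\hat\rho\hat D(s,t)|\bar k\rangle$. The syndrome distribution is $\mathrm{Pr}[(s,t)|\hat\rho]=\mathrm{Tr}[\hat\rho\hat P_{(s,t)}]=\mathrm{Tr}\,\underline\rho(s,t)$, and the normalised error-corrected logical state is $\underline\rho'(s,t)=\underline\rho(s,t)/\mathrm{Pr}[(s,t)|\hat\rho]$ (where the density is positive). **Statement.** The function $W_{\hat\rho}$ exists, $\underline\rho(s,t)$ is positive semidefinite for almost every $(s,t)$, $\mathrm{Pr}[\,\cdot\,|\hat\rho]$ is a probability density on $\mathbb T^2_\ell$, the integrand below is integrable, and $$\mathcal N_{\hat\rho}=\int_{\mathbb T^2_\ell}\mathrm{Pr}[(s,t)|\hat\rho]\;\mathcal N^{\mathrm{DV}}_{\underline\rho'(s,t)}\,ds\,dt .$$ Consequently the negative volume detects the negativity (magic) of the logical content of every such state: $\mathcal N_{\hat\rho}\ge1$, with equality if and only if $W^{\mathrm{DV}}_{\underline\rho'(s,t)}\ge0$ for almost every $(s,t)$ with $\mathrm{Pr}[(s,t)|\hat\rho]>0$. -/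

import Mathlib

open MeasureTheory Set
open scoped ComplexOrder ENNReal

noncomputable section

/-! ### The continuous-variable system -/

/-- The Hilbert space `L²(ℝ)` of one bosonic mode, in the position representation. -/
abbrev CVSpace : Type := Lp ℂ 2 (volume : Measure ℝ)

/-- The displacement `D(x, p) = exp(i x p / 2) exp(-i x P) exp(i p X) = exp(i (p X - x P))` on wave
functions: `(D(x, p) f)(y) = exp(i p (y - x / 2)) f(y - x)`. -/
def displaceFun (x p : ℝ) (f : ℝ → ℂ) (y : ℝ) : ℂ :=
  Complex.exp (Complex.I * ((p * (y - x / 2) : ℝ) : ℂ)) * f (y - x)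

theorem norm_displaceFun (x p : ℝ) (f : ℝ → ℂ) (y : ℝ) :
    ‖displaceFun x p f y‖ = ‖f (y - x)‖ := by
  rw [displaceFun, norm_mul, mul_comm Complex.I, Complex.norm_exp_ofReal_mul_I, one_mul]

theorem measurePreserving_sub (x : ℝ) :
    MeasurePreserving (fun y : ℝ => y - x) volume volume :=
  measurePreserving_sub_right volume x

theorem aestronglyMeasurable_displaceFun (x p : ℝ) {f : ℝ → ℂ}
    (hf : AEStronglyMeasurable f volume) :
    AEStronglyMeasurable (displaceFun x p f) volume := by
  have h1 : Continuous fun y : ℝ => Complex.exp (Complex.I * ((p * (y - x / 2) : ℝ) : ℂ)) := by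
    fun_prop
  exact h1.aestronglyMeasurable.mul (hf.comp_measurePreserving (measurePreserving_sub x))

theorem eLpNorm_displaceFun (x p : ℝ) {f : ℝ → ℂ} (hf : AEStronglyMeasurable f volume) :
    eLpNorm (displaceFun x p f) 2 volume = eLpNorm f 2 volume := by
  rw [← eLpNorm_comp_measurePreserving hf (measurePreserving_sub x)]
  exact eLpNorm_congr_norm_ae (Filter.Eventually.of_forall fun y => norm_displaceFun x p f y)

theorem memLp_displaceFun (x p : ℝ) (f : CVSpace) : MemLp (displaceFun x p f) 2 volume := by
  refine ⟨aestronglyMeasurable_displaceFun x p (Lp.aestronglyMeasurable f), ?_⟩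
  rw [eLpNorm_displaceFun x p (Lp.aestronglyMeasurable f)]
  exact Lp.eLpNorm_lt_top f

/-- Functions that agree almost everywhere have displacements that agree almost everywhere. -/
theorem displaceFun_congr_ae (x p : ℝ) {f g : ℝ → ℂ} (h : f =ᵐ[volume] g) :
    displaceFun x p f =ᵐ[volume] displaceFun x p g := by
  have h2 := (measurePreserving_sub x).quasiMeasurePreserving.ae_eq_comp h
  filter_upwards [h2] with y hy
  simp only [Function.comp_apply] at hy
  simp only [displaceFun, hy]

/-- The unitary displacement operator `D(x, p)` on `L²(ℝ)`. -/
def displacement (x p : ℝ) : CVSpace →L[ℂ] CVSpace :=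
  LinearIsometry.toContinuousLinearMap
    { toFun := fun f => (memLp_displaceFun x p f).toLp
      map_add' := by
        intro f g
        rw [← MemLp.toLp_add]
        refine MemLp.toLp_congr _ _ ?_
        refine (displaceFun_congr_ae x p (Lp.coeFn_add f g)).trans ?_
        refine Filter.Eventually.of_forall fun y => ?_
        simp only [displaceFun, Pi.add_apply, mul_add]
      map_smul' := by
        intro c f
        rw [RingHom.id_apply, ← MemLp.toLp_const_smul]
        refine MemLp.toLp_congr _ _ ?_
        refine (displaceFun_congr_ae x p (Lp.coeFn_smul c f)).trans ?_
        refine Filter.Eventually.of_forall fun y => ?_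
        simp only [displaceFun, Pi.smul_apply, smul_eq_mul]
        ring
      norm_map' := by
        intro f
        change ‖(memLp_displaceFun x p f).toLp‖ = ‖f‖
        rw [Lp.norm_toLp, Lp.norm_def,
          eLpNorm_displaceFun x p (Lp.aestronglyMeasurable f)] }

/-! ### Traces and density operators -/

/-- Index set of a fixed orthonormal basis of `L²(ℝ)`. -/
def refIndex : Set CVSpace := (exists_hilbertBasis ℂ CVSpace).choose

/-- A fixed orthonormal (Hilbert) basis of `L²(ℝ)`. -/
def refBasis : HilbertBasis refIndex ℂ CVSpace :=
  (exists_hilbertBasis ℂ CVSpace).choose_spec.choose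

/-- The trace `∑ᵢ ⟨eᵢ, A eᵢ⟩`; for trace-class `A` the series converges absolutely and its sum does
not depend on the orthonormal basis. -/
def opTrace (A : CVSpace →L[ℂ] CVSpace) : ℂ :=
  ∑' i, inner ℂ (refBasis i) (A (refBasis i))

/-- The positive square root of a positive operator. -/
def opSqrt {H : Type} [NormedAddCommGroup H] [InnerProductSpace ℂ H] [CompleteSpace H]
    (A : H →L[ℂ] H) : H →L[ℂ] H :=
  CFC.sqrt A

theorem opSqrt_isPositive {H : Type} [NormedAddCommGroup H] [InnerProductSpace ℂ H]
    [CompleteSpace H] (A : H →L[ℂ] H) : (opSqrt A).IsPositive :=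
  (ContinuousLinearMap.nonneg_iff_isPositive _).1 (CFC.sqrt_nonneg A)

theorem opSqrt_mul_self {H : Type} [NormedAddCommGroup H] [InnerProductSpace ℂ H]
    [CompleteSpace H] {A : H →L[ℂ] H} (hA : A.IsPositive) : opSqrt A * opSqrt A = A :=
  CFC.sqrt_mul_sqrt_self A ((ContinuousLinearMap.nonneg_iff_isPositive _).2 hA)

/-- A continuous-variable state: a positive operator whose trace is finite and equal to `1`. -/
structure IsDensityOperator (ρ : CVSpace →L[ℂ] CVSpace) : Prop where
  pos : ρ.IsPositive
  trace_one : HasSum (fun i => inner ℂ (refBasis i) (ρ (refBasis i))) (1 : ℂ)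

/-! ### The square GKP code and its syndromes -/

/-- The logical step size `ℓ = √(2π / d)`. -/
def step (d : ℕ) : ℝ := Real.sqrt (2 * Real.pi / d)

/-- The cell `[0, ℓ) × [0, ℓ)` of syndromes `(s, t)`. -/
def syndromeCell (d : ℕ) : Set (ℝ × ℝ) := Ico 0 (step d) ×ˢ Ico 0 (step d)

/-- The toroidal phase space `[0, dℓ) × [0, dℓ)`. -/
def phaseTorus (d : ℕ) : Set (ℝ × ℝ) := Ico 0 (d * step d) ×ˢ Ico 0 (d * step d)

/-- The `n`-th term of the Dirac comb `⟨j̄| D(s, t)† |ψ⟩ = ℓ^(-1/2) ∑ₙ (D(s, t)† ψ)(jℓ + n dℓ)`, as a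
function of `(s, t)`; recall `D(s, t)† = D(-s, -t)` and
`|j̄⟩ = ℓ^(-1/2) ∑ₙ |jℓ + n dℓ⟩`. -/
def combTerm (d : ℕ) (j : ZMod d) (ψ : CVSpace) (n : ℤ) (z : ℝ × ℝ) : ℂ :=
  ((1 / Real.sqrt (step d) : ℝ) : ℂ) *
    displaceFun (-z.1) (-z.2) ψ (j.val * step d + n * (d * step d))

theorem memLp_combTerm (d : ℕ) (j : ZMod d) (ψ : CVSpace) (n : ℤ) :
    MemLp (combTerm d j ψ n) 2 (volume.restrict (syndromeCell d)) := by
  set c : ℝ := j.val * step d + n * (d * step d) with hc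
  have hmp : MeasurePreserving (fun s : ℝ => c + s) volume volume :=
    measurePreserving_add_left volume c
  have h1 : MemLp (fun s : ℝ => ψ (c + s)) 2 (volume.restrict (Ico 0 (step d))) :=
    ((Lp.memLp ψ).comp_measurePreserving hmp).restrict _
  have hvol : (volume.restrict (syndromeCell d) : Measure (ℝ × ℝ)) =
      (volume.restrict (Ico 0 (step d))).prod (volume.restrict (Ico 0 (step d))) := by
    rw [Measure.prod_restrict]; rfl
  rw [hvol]
  have h2 := h1.comp_fst (volume.restrict (Ico 0 (step d)))
  have hcont : Continuous fun z : ℝ × ℝ => ((1 / Real.sqrt (step d) : ℝ) : ℂ) *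
      Complex.exp (Complex.I * ((-z.2 * (c - -z.1 / 2) : ℝ) : ℂ)) := by
    fun_prop
  have hform : combTerm d j ψ n = fun z : ℝ × ℝ => (((1 / Real.sqrt (step d) : ℝ) : ℂ) *
      Complex.exp (Complex.I * ((-z.2 * (c - -z.1 / 2) : ℝ) : ℂ))) * ψ (c + z.1) := by
    funext z
    simp only [combTerm, displaceFun, ← hc, sub_neg_eq_add, mul_assoc]
  rw [hform]
  refine h2.of_le_mul (c := ‖((1 / Real.sqrt (step d) : ℝ) : ℂ)‖)
    (hcont.aestronglyMeasurable.mul h2.1) (Filter.Eventually.of_forall fun z => ?_)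
  rw [norm_mul, norm_mul, mul_comm Complex.I, Complex.norm_exp_ofReal_mul_I, mul_one]

/-- The amplitude `⟨j̄| D(s, t)† |ψ⟩` as a function of the syndrome `(s, t)`. For `ψ` in `L²(ℝ)` the
comb series has mutually orthogonal terms in `L²` of the syndrome cell and converges there
unconditionally (it is a Zak transform of `ψ`); its values are defined almost everywhere. -/
def codeAmplitude (d : ℕ) (j : ZMod d) (ψ : CVSpace) :
    Lp ℂ 2 (volume.restrict (syndromeCell d)) :=
  ∑' n : ℤ, (memLp_combTerm d j ψ n).toLp

/-- The (sub-normalised) logical state of the error-corrected state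
`P D(s, t)† ρ D(s, t) P`, where `P = ∑ⱼ |j̄⟩⟨j̄|`: the `d × d` matrix of the numbers
`⟨j̄| D(s, t)† ρ D(s, t) |k̄⟩`. Since the code words are not elements of `L²(ℝ)`, the entry is computed
from `ρ = ∑ᵢ |√ρ eᵢ⟩⟨√ρ eᵢ|`, that is, as
`∑ᵢ ⟨j̄| D(s, t)† |√ρ eᵢ⟩⟨√ρ eᵢ| D(s, t) |k̄⟩`. -/
def logicalState (d : ℕ) (ρ : CVSpace →L[ℂ] CVSpace) (z : ℝ × ℝ) :
    Matrix (ZMod d) (ZMod d) ℂ :=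
  fun j k => ∑' i, codeAmplitude d j (opSqrt ρ (refBasis i)) z *
    star (codeAmplitude d k (opSqrt ρ (refBasis i)) z)

/-- The syndrome density
`Pr[(s, t) | ρ] = Tr[ρ P_(s, t)] = ∑ⱼ ⟨j̄| D(s, t)† ρ D(s, t) |j̄⟩`, where
`P_(s, t) = ∑ⱼ D(s, t) |j̄⟩⟨j̄| D(s, t)†`. -/
def syndromeProb (d : ℕ) [NeZero d] (ρ : CVSpace →L[ℂ] CVSpace) (z : ℝ × ℝ) : ℝ :=
  (logicalState d ρ z).trace.re

/-- The normalised logical state after error correction with syndrome `z = (s, t)`. -/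
def normalizedLogicalState (d : ℕ) [NeZero d] (ρ : CVSpace →L[ℂ] CVSpace) (z : ℝ × ℝ) :
    Matrix (ZMod d) (ZMod d) ℂ :=
  ((syndromeProb d ρ z : ℂ)⁻¹) • logicalState d ρ z

/-! ### The Gross Wigner function of a qudit -/

/-- `ω = exp(2πi / d)`. -/
def rootOfUnity (d : ℕ) : ℂ := Complex.exp (2 * Real.pi * Complex.I / d)

/-- The shift `X |j⟩ = |j + 1⟩`. -/
def pauliX (d : ℕ) : Matrix (ZMod d) (ZMod d) ℂ :=
  Matrix.of fun i j => if i = j + 1 then 1 else 0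

/-- The clock `Z |j⟩ = ω ^ j |j⟩`. -/
def pauliZ (d : ℕ) : Matrix (ZMod d) (ZMod d) ℂ :=
  Matrix.diagonal fun j => rootOfUnity d ^ j.val

/-- The discrete displacement `D_d(a, b) = ω ^ (a b / 2) X ^ a Z ^ b`, where `1 / 2` stands for
`(d + 1) / 2`, the inverse of `2` modulo the odd number `d`. -/
def qudisplacement (d : ℕ) [NeZero d] (a b : ZMod d) : Matrix (ZMod d) (ZMod d) ℂ :=
  rootOfUnity d ^ ((d + 1) / 2 * a.val * b.val) • (pauliX d ^ a.val * pauliZ d ^ b.val)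

/-- The parity `|j⟩ ↦ |-j⟩`. -/
def parity (d : ℕ) : Matrix (ZMod d) (ZMod d) ℂ :=
  Matrix.of fun i j => if i = -j then 1 else 0

/-- The displaced parity `D_d(a, b) Π D_d(a, b)†`. -/
def displacedParity (d : ℕ) [NeZero d] (a b : ZMod d) : Matrix (ZMod d) (ZMod d) ℂ :=
  qudisplacement d a b * parity d * (qudisplacement d a b).conjTranspose

/-- The Gross Wigner function `W(a, b) = Tr[Π_d(a, b) M]`, normalised by `(1 / d) ∑ W = Tr M`. -/
def grossWigner (d : ℕ) [NeZero d] (M : Matrix (ZMod d) (ZMod d) ℂ) (a b : ZMod d) : ℂ :=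
  (displacedParity d a b * M).trace

/-- The negative volume `(1 / d) ∑ |W(a, b)|` of the Gross Wigner function. -/
def grossNegVolume (d : ℕ) [NeZero d] (M : Matrix (ZMod d) (ZMod d) ℂ) : ℝ :=
  1 / d * ∑ a : ZMod d, ∑ b : ZMod d, ‖grossWigner d M a b‖

/-! ### The Zak--Gross Wigner function -/

/-- `W` is a Zak--Gross Wigner function of `ρ`, that is, on the torus,
`W(u, v) = (1 / 2π) ∑_{m, n} (-1) ^ (m n) exp(i ℓ (n v - m u)) Tr[D(nℓ, mℓ) ρ]`.
For a general state the series does not converge pointwise; it is understood as the Fourier series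
of the integrable function `W` (which it determines almost everywhere): for all `m, n` the
`(m, n)`-th Fourier coefficient of `W` on the torus, whose area is `(d ℓ) ^ 2`, is
`(1 / 2π) (-1) ^ (m n) Tr[D(nℓ, mℓ) ρ]`. -/
structure IsZakGrossWigner (d : ℕ) (ρ : CVSpace →L[ℂ] CVSpace) (W : ℝ × ℝ → ℂ) : Prop where
  integrable : IntegrableOn W (phaseTorus d)
  fourierCoeff_eq : ∀ m n : ℤ,
    ((1 / (d * step d) ^ 2 : ℝ) : ℂ) * ∫ z in phaseTorus d,
        Complex.exp (-Complex.I * ((step d * (n * z.2 - m * z.1) : ℝ) : ℂ)) * W z =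
      ((1 / (2 * Real.pi) : ℝ) : ℂ) * (-1) ^ (m * n) *
        opTrace (displacement (n * step d) (m * step d) * ρ)

/-- The negative volume of a function on the torus: the integral of its modulus for the invariant
measure `(1 / d) du dv`. -/
def torusNegVolume (d : ℕ) (W : ℝ × ℝ → ℂ) : ℝ :=
  ∫ z in phaseTorus d, 1 / d * ‖W z‖

end

/-!
# The Zak–Gross Wigner function and the average discrete Wigner negativity

Write `B_k(s, t) = ⟨k̄| D(s, t)† |ψ⟩` for the code amplitudes of a pure state `ψ`. The central
fact is that the Zak–Gross Wigner function is, cell by cell, a discrete Wigner function: at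
`(u, v) = (s + a ℓ, t + b ℓ)`, with `(s, t)` in the syndrome cell, it equals the Gross Wigner
function at `(a, b)` of the sub-normalised logical state with syndrome `(s, t)`. Everything else
follows: the
torus is a disjoint union of `d ^ 2` translates of the cell, so integrating the modulus over the
torus gives the integral over the cell of the discrete negative volume.

To establish this fact, one takes the function that is given by the discrete Wigner functions
(`zakGrossWigner`), computes its Fourier coefficients and compares.

* The displaced parity is `|k⟩ ↦ ω ^ (2 b (a - k)) |2a - k⟩`, so the finite Fourier transform of a
  Gross Wigner function is a weighted sum over one diagonal of the matrix
  (`sum_stdAddChar_mul_grossWigner`). As `ℓ ^ 2 = 2 π / d`, a character of the torus splits into a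
  character of `ℤ / d × ℤ / d` and its restriction to the cell, which reduces the Fourier
  coefficient to the integrals of `exp(-i ℓ (n t - m s)) B_k conj(B_{k + n})` over the cell
  (`setIntegral_torusChar_mul_torusFun`).
* A lattice displacement `D(n ℓ, m ℓ)` permutes the code words up to phases and commutes with
  `D(s, t)` up to exactly this character, so multiplying `B_k` by the character gives the amplitude
  `B_{k + n}` of the displaced state, up to a phase (`codeAmplitude_displacement`).
* The amplitudes form a Zak transform, which is isometric (`sum_inner_codeAmplitude`). Hence the
  integrals sum to `⟨ψ, D(n ℓ, m ℓ) ψ⟩`, and the phases combine to `(-1) ^ (m n)`; this uses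
  that `d` is odd (`stdAddChar_halfMod_mul_phase`).
* A density operator is the sum of the rank-one operators of the vectors `√ρ eᵢ`; all series
  converge absolutely in `L¹`, and cyclicity of the trace (`tsum_inner_mul_mul_self`) identifies the
  sum with the trace in the definition.

Fourier coefficients determine an integrable function on the torus almost everywhere
(`ae_eq_zero_of_fourier`), so the negative volume is the same for every Zak–Gross Wigner function.
Finally, the discrete Wigner function of a matrix `M` sums to `d Tr M`, so its negative volume is at
least `Re Tr M`, with equality exactly when all its values are nonnegative
(`grossNegVolume_eq_re_trace_iff`); integrating gives the bound and the case of equality.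
-/

noncomputable section

/-! ### The Gross Wigner function in coordinates -/

theorem rootOfUnity_pow (d : ℕ) [NeZero d] (k : ℕ) :
    rootOfUnity d ^ k = ZMod.stdAddChar (k : ZMod d) := by
  have h := ZMod.stdAddChar_coe (N := d) (k : ℤ)
  rw [Int.cast_natCast] at h
  rw [h, rootOfUnity, ← Complex.exp_nat_mul]
  congr 1
  push_cast
  ring

theorem star_stdAddChar {d : ℕ} [NeZero d] (x : ZMod d) :
    star (ZMod.stdAddChar x : ℂ) = ZMod.stdAddChar (-x) := by
  exact (AddChar.map_neg_eq_conj ZMod.stdAddChar x).symm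

theorem stdAddChar_mul {d : ℕ} [NeZero d] (x y : ZMod d) :
    (ZMod.stdAddChar x : ℂ) * ZMod.stdAddChar y = ZMod.stdAddChar (x + y) :=
  (AddChar.map_add_eq_mul ZMod.stdAddChar x y).symm

/-- The inverse of `2` in `ℤ / d`, for odd `d`. -/
def halfMod (d : ℕ) : ZMod d := (((d + 1) / 2 : ℕ) : ZMod d)

theorem two_mul_halfMod {d : ℕ} (hd : Odd d) : 2 * halfMod d = 1 := by
  obtain ⟨k, rfl⟩ := hd
  have h : (2 * k + 1 + 1) / 2 = k + 1 := by omega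
  rw [halfMod, h]
  have h2 : ((2 * k + 1 : ℕ) : ZMod (2 * k + 1)) = 0 := ZMod.natCast_self _
  push_cast at h2 ⊢
  linear_combination h2

theorem pauliX_pow_apply (d : ℕ) [NeZero d] (n : ℕ) (i j : ZMod d) :
    (pauliX d ^ n) i j = if i = j + n then 1 else 0 := by
  induction n generalizing i with
  | zero => simp [Matrix.one_apply]
  | succ n ih =>
    rw [pow_succ', Matrix.mul_apply]
    simp only [pauliX, Matrix.of_apply] at ih ⊢
    simp only [ih, ite_mul, one_mul, zero_mul]
    rw [Finset.sum_eq_single (i - 1)]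
    · simp only [sub_add_cancel, if_true, Nat.cast_add, Nat.cast_one]
      refine if_congr ⟨fun h => ?_, fun h => ?_⟩ rfl rfl <;> linear_combination h
    · intro k _ hk
      rw [if_neg]
      intro h
      exact hk (by linear_combination -h)
    · simp

theorem qudisplacement_apply (d : ℕ) [NeZero d] (a b i j : ZMod d) :
    qudisplacement d a b i j =
      if i = j + a then ZMod.stdAddChar (halfMod d * a * b + b * j) else 0 := by
  rw [qudisplacement, Matrix.smul_apply, pauliZ, Matrix.diagonal_pow, Matrix.mul_diagonal,
    pauliX_pow_apply, Pi.pow_apply, smul_eq_mul, ← pow_mul, rootOfUnity_pow, rootOfUnity_pow,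
    ite_mul, one_mul, zero_mul, mul_ite, mul_zero, stdAddChar_mul]
  push_cast
  simp only [ZMod.natCast_val, ZMod.cast_id', id, halfMod]
  rw [mul_comm j b]

/-- The displaced parity is the reflection `|k⟩ ↦ ω ^ (2 b (a - k)) |2a - k⟩`. -/
theorem displacedParity_apply (d : ℕ) [NeZero d] (a b i k : ZMod d) :
    displacedParity d a b i k =
      if i = 2 * a - k then ZMod.stdAddChar (2 * b * (a - k)) else 0 := by
  have h1 : ∀ x, (qudisplacement d a b * parity d) i x =
      if i = a - x then ZMod.stdAddChar (halfMod d * a * b + b * (-x)) else 0 := by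
    intro x
    rw [Matrix.mul_apply, Finset.sum_eq_single (-x)]
    · rw [parity, Matrix.of_apply, if_pos rfl, mul_one, qudisplacement_apply]
      exact if_congr (by rw [neg_add_eq_sub]) rfl rfl
    · intro y _ hy
      rw [parity, Matrix.of_apply, if_neg hy, mul_zero]
    · simp
  rw [displacedParity, Matrix.mul_apply, Finset.sum_eq_single (k - a)]
  · rw [h1, Matrix.conjTranspose_apply, qudisplacement_apply, if_pos (sub_add_cancel k a).symm,
      star_stdAddChar,
      ite_mul, zero_mul, stdAddChar_mul]
    have e : halfMod d * a * b + b * -(k - a) + -(halfMod d * a * b + b * (k - a)) =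
      2 * b * (a - k) := by ring
    rw [e]
    exact if_congr (by rw [show a - (k - a) = 2 * a - k by ring]) rfl rfl
  · intro y _ hy
    rw [Matrix.conjTranspose_apply, qudisplacement_apply, if_neg, star_zero, mul_zero]
    intro h
    exact hy (by linear_combination -h)
  · simp

theorem grossWigner_eq_sum (d : ℕ) [NeZero d] (M : Matrix (ZMod d) (ZMod d) ℂ) (a b : ZMod d) :
    grossWigner d M a b = ∑ k, ZMod.stdAddChar (2 * b * (a - k)) * M k (2 * a - k) := by
  rw [grossWigner, Matrix.trace_mul_comm, Matrix.trace]
  refine Finset.sum_congr rfl fun k _ => ?_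
  rw [Matrix.diag_apply, Matrix.mul_apply, Finset.sum_eq_single (2 * a - k)]
  · rw [displacedParity_apply, if_pos rfl, mul_comm]
  · intro y _ hy
    rw [displacedParity_apply, if_neg, mul_zero]
    exact hy
  · simp

/-- The finite Fourier transform of the Gross Wigner function picks out one diagonal of the
matrix. -/
theorem sum_stdAddChar_mul_grossWigner (d : ℕ) [NeZero d] (hd : Odd d)
    (M : Matrix (ZMod d) (ZMod d) ℂ) (m n : ZMod d) :
    ∑ a, ∑ b, ZMod.stdAddChar (m * a - n * b) * grossWigner d M a b =
      d * ZMod.stdAddChar (m * n * halfMod d) *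
        ∑ k, ZMod.stdAddChar (m * k) * M k (k + n) := by
  have h2 := two_mul_halfMod hd
  -- the sum over `b` forces `2 (a - k) = n`, that is, `a = k + n / 2`
  have hb : ∀ a k : ZMod d, ∑ b : ZMod d, (ZMod.stdAddChar (b * (2 * (a - k) - n)) : ℂ) =
      if a = k + n * halfMod d then (d : ℂ) else 0 := by
    intro a k
    rw [AddChar.sum_mulShift _ (ZMod.isPrimitive_stdAddChar d), ZMod.card]
    have : 2 * (a - k) - n = 0 ↔ a = k + n * halfMod d := by
      refine ⟨fun h => ?_, fun h => ?_⟩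
      · linear_combination halfMod d * h - (a - k) * h2
      · rw [h]
        linear_combination n * h2
    rw [apply_ite (Nat.cast : ℕ → ℂ), Nat.cast_zero]
    exact if_congr this rfl rfl
  calc ∑ a, ∑ b, ZMod.stdAddChar (m * a - n * b) * grossWigner d M a b
      = ∑ a, ∑ k, (∑ b : ZMod d, (ZMod.stdAddChar (b * (2 * (a - k) - n)) : ℂ)) *
          (ZMod.stdAddChar (m * a) * M k (2 * a - k)) := by
        refine Finset.sum_congr rfl fun a _ => ?_
        simp only [Finset.sum_mul]
        rw [Finset.sum_comm]
        refine Finset.sum_congr rfl fun b _ => ?_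
        rw [grossWigner_eq_sum, Finset.mul_sum]
        refine Finset.sum_congr rfl fun k _ => ?_
        rw [← mul_assoc, ← mul_assoc, stdAddChar_mul, stdAddChar_mul]
        congr 2
        ring
    _ = ∑ k, (d : ℂ) * (ZMod.stdAddChar (m * (k + n * halfMod d)) *
          M k (2 * (k + n * halfMod d) - k)) := by
        rw [Finset.sum_comm]
        refine Finset.sum_congr rfl fun k _ => ?_
        rw [Finset.sum_eq_single (k + n * halfMod d)]
        · rw [hb, if_pos rfl]
        · intro a _ ha
          rw [hb, if_neg ha, zero_mul]
        · simp
    _ = _ := by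
        rw [Finset.mul_sum]
        refine Finset.sum_congr rfl fun k _ => ?_
        have e1 : 2 * (k + n * halfMod d) - k = k + n := by linear_combination n * h2
        rw [e1, mul_add, ← stdAddChar_mul, ← mul_assoc m n]
        ring

theorem sum_grossWigner (d : ℕ) [NeZero d] (hd : Odd d) (M : Matrix (ZMod d) (ZMod d) ℂ) :
    ∑ a, ∑ b, grossWigner d M a b = d * M.trace := by
  have h := sum_stdAddChar_mul_grossWigner d hd M 0 0
  simpa [Matrix.trace] using h

theorem grossWigner_smul (d : ℕ) [NeZero d] (c : ℂ) (M : Matrix (ZMod d) (ZMod d) ℂ)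
    (a b : ZMod d) : grossWigner d (c • M) a b = c * grossWigner d M a b := by
  rw [grossWigner, Matrix.mul_smul, Matrix.trace_smul, smul_eq_mul, grossWigner]

/-! ### The phase-space torus as a union of translated syndrome cells -/

theorem step_pos (d : ℕ) [NeZero d] : 0 < step d := by
  have hd : (0 : ℝ) < d := Nat.cast_pos.2 (NeZero.pos d)
  exact Real.sqrt_pos.2 (div_pos Real.two_pi_pos hd)

theorem mul_step_sq (d : ℕ) [NeZero d] : d * step d ^ 2 = 2 * Real.pi := by
  have hd : (0 : ℝ) < d := Nat.cast_pos.2 (NeZero.pos d)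
  rw [step, Real.sq_sqrt (div_pos Real.two_pi_pos hd).le]
  field_simp

theorem measurableSet_syndromeCell (d : ℕ) : MeasurableSet (syndromeCell d) :=
  measurableSet_Ico.prod measurableSet_Ico

/-- The lattice vector `(a ℓ, b ℓ)`, for the representatives of `a` and `b` in `{0, …, d - 1}`. -/
def cellCorner (d : ℕ) (q : ZMod d × ZMod d) : ℝ × ℝ := (q.1.val * step d, q.2.val * step d)

/-- The syndrome cell translated by `(a ℓ, b ℓ)`. -/
def translatedCell (d : ℕ) (q : ZMod d × ZMod d) : Set (ℝ × ℝ) :=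
  (fun z => z - cellCorner d q) ⁻¹' syndromeCell d

theorem measurableSet_translatedCell (d : ℕ) (q : ZMod d × ZMod d) :
    MeasurableSet (translatedCell d q) :=
  (measurable_id.sub_const _) (measurableSet_syndromeCell d)

theorem floor_div_step_eq_iff (d : ℕ) [NeZero d] (u : ℝ) (k : ℤ) :
    ⌊u / step d⌋ = k ↔ u - k * step d ∈ Ico 0 (step d) := by
  have h := step_pos d
  rw [Int.floor_eq_iff, le_div_iff₀ h, div_lt_iff₀ h, mem_Ico]
  refine and_congr ⟨fun h => by linarith, fun h => by linarith⟩
    ⟨fun h => by linarith, fun h => by linarith⟩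

theorem mem_translatedCell_iff (d : ℕ) [NeZero d] (q : ZMod d × ZMod d) (z : ℝ × ℝ) :
    z ∈ translatedCell d q ↔
      ⌊z.1 / step d⌋ = (q.1.val : ℤ) ∧ ⌊z.2 / step d⌋ = (q.2.val : ℤ) := by
  rw [floor_div_step_eq_iff, floor_div_step_eq_iff]
  rfl

theorem pairwise_disjoint_translatedCell (d : ℕ) [NeZero d] :
    Pairwise (Function.onFun Disjoint (translatedCell d)) := by
  intro q r hqr
  refine Set.disjoint_left.2 fun z hq hr => hqr ?_
  rw [mem_translatedCell_iff] at hq hr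
  refine Prod.ext (ZMod.val_injective d ?_) (ZMod.val_injective d ?_)
  · exact_mod_cast hq.1.symm.trans hr.1
  · exact_mod_cast hq.2.symm.trans hr.2

theorem mem_Ico_mul_step_iff (d : ℕ) [NeZero d] (u : ℝ) :
    u ∈ Ico 0 (d * step d) ↔ ∃ a : ZMod d, ⌊u / step d⌋ = (a.val : ℤ) := by
  have h := step_pos d
  have h1 : u ∈ Ico 0 (d * step d) ↔ 0 ≤ ⌊u / step d⌋ ∧ ⌊u / step d⌋ < d := by
    rw [Int.floor_nonneg, Int.floor_lt, Int.cast_natCast, div_lt_iff₀ h, mem_Ico,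
      le_div_iff₀ h, zero_mul]
  rw [h1]
  constructor
  · rintro ⟨h0, hlt⟩
    obtain ⟨k, hk⟩ := Int.eq_ofNat_of_zero_le h0
    refine ⟨(k : ZMod d), ?_⟩
    rw [ZMod.val_natCast_of_lt (by omega), hk]
  · rintro ⟨a, ha⟩
    have := ZMod.val_lt a
    omega

theorem phaseTorus_eq_iUnion (d : ℕ) [NeZero d] :
    phaseTorus d = ⋃ q, translatedCell d q := by
  ext z
  rw [mem_iUnion, phaseTorus, mem_prod, mem_Ico_mul_step_iff, mem_Ico_mul_step_iff]
  constructor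
  · rintro ⟨⟨a, ha⟩, b, hb⟩
    exact ⟨(a, b), (mem_translatedCell_iff d _ z).2 ⟨ha, hb⟩⟩
  · rintro ⟨q, hq⟩
    obtain ⟨h1, h2⟩ := (mem_translatedCell_iff d _ z).1 hq
    exact ⟨⟨_, h1⟩, _, h2⟩

theorem restrict_phaseTorus (d : ℕ) [NeZero d] :
    volume.restrict (phaseTorus d) = ∑ q : ZMod d × ZMod d,
      (volume.restrict (syndromeCell d)).map (MeasurableEquiv.addRight (cellCorner d q)) := by
  rw [phaseTorus_eq_iUnion, Measure.restrict_iUnion (pairwise_disjoint_translatedCell d)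
    (measurableSet_translatedCell d), Measure.sum_fintype]
  refine Finset.sum_congr rfl fun q _ => ?_
  have h := (measurePreserving_add_right (volume : Measure (ℝ × ℝ))
    (cellCorner d q)).restrict_preimage
    (measurableSet_translatedCell d q)
  have e : (fun z => z + cellCorner d q) ⁻¹' translatedCell d q = syndromeCell d := by
    ext z
    simp [translatedCell]
  rw [e] at h
  exact h.map_eq.symm

theorem integrableOn_phaseTorus_iff (d : ℕ) [NeZero d] (F : ℝ × ℝ → ℂ) :
    IntegrableOn F (phaseTorus d) ↔
      ∀ q, IntegrableOn (fun z => F (z + cellCorner d q)) (syndromeCell d) := by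
  rw [IntegrableOn, restrict_phaseTorus, integrable_finsetSum_measure]
  refine ⟨fun h q => ?_, fun h q _ => ?_⟩
  · exact ((MeasurableEquiv.addRight (cellCorner d q)).measurableEmbedding.integrable_map_iff).1
      (h q (Finset.mem_univ q))
  · exact ((MeasurableEquiv.addRight (cellCorner d q)).measurableEmbedding.integrable_map_iff).2
      (h q)

theorem setIntegral_phaseTorus {E : Type*} [NormedAddCommGroup E] [NormedSpace ℝ E]
    (d : ℕ) [NeZero d] {F : ℝ × ℝ → E}
    (hF : ∀ q, IntegrableOn (fun z => F (z + cellCorner d q)) (syndromeCell d)) :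
    ∫ z in phaseTorus d, F z =
      ∑ a : ZMod d, ∑ b : ZMod d, ∫ z in syndromeCell d, F (z + cellCorner d (a, b)) := by
  rw [restrict_phaseTorus, integral_finsetSum_measure, ← Finset.sum_product']
  · refine Finset.sum_congr rfl fun q _ => ?_
    rw [(MeasurableEquiv.addRight (cellCorner d q)).measurableEmbedding.integral_map]
    rfl
  · intro q _
    exact ((MeasurableEquiv.addRight (cellCorner d q)).measurableEmbedding.integrable_map_iff).2
      (hF q)

/-- The function on the torus that is `w a b` on the translate of the syndrome cell by
`(a ℓ, b ℓ)`. -/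
def torusFun (d : ℕ) (w : ZMod d → ZMod d → ℝ × ℝ → ℂ) (z : ℝ × ℝ) : ℂ :=
  w (⌊z.1 / step d⌋ : ℤ) (⌊z.2 / step d⌋ : ℤ)
    (z.1 - ⌊z.1 / step d⌋ * step d, z.2 - ⌊z.2 / step d⌋ * step d)

theorem torusFun_add_cellCorner (d : ℕ) [NeZero d] (w : ZMod d → ZMod d → ℝ × ℝ → ℂ)
    (a b : ZMod d) {z : ℝ × ℝ} (hz : z ∈ syndromeCell d) :
    torusFun d w (z + cellCorner d (a, b)) = w a b z := by
  have h1 : ⌊(z + cellCorner d (a, b)).1 / step d⌋ = (a.val : ℤ) := by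
    rw [floor_div_step_eq_iff]
    simpa [cellCorner] using hz.1
  have h2 : ⌊(z + cellCorner d (a, b)).2 / step d⌋ = (b.val : ℤ) := by
    rw [floor_div_step_eq_iff]
    simpa [cellCorner] using hz.2
  rw [torusFun, h1, h2]
  simp [cellCorner]

/-- The character `exp(-i ℓ (n v - m u))` of the torus. -/
def torusChar (d : ℕ) (m n : ℤ) (z : ℝ × ℝ) : ℂ :=
  Complex.exp (-Complex.I * ((step d * (n * z.2 - m * z.1) : ℝ) : ℂ))

theorem continuous_torusChar (d : ℕ) (m n : ℤ) : Continuous (torusChar d m n) := by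
  unfold torusChar
  fun_prop

theorem norm_torusChar (d : ℕ) (m n : ℤ) (z : ℝ × ℝ) : ‖torusChar d m n z‖ = 1 := by
  rw [torusChar, show ∀ x : ℝ, -Complex.I * (x : ℂ) = ((-x : ℝ) : ℂ) * Complex.I by
    intro x; push_cast; ring, Complex.norm_exp_ofReal_mul_I]

theorem integrable_torusChar_mul {d : ℕ} (m n : ℤ) {μ : Measure (ℝ × ℝ)} {F : ℝ × ℝ → ℂ}
    (hF : Integrable F μ) : Integrable (fun z => torusChar d m n z * F z) μ :=
  hF.bdd_mul (c := 1) (continuous_torusChar d m n).aestronglyMeasurable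
    (Filter.Eventually.of_forall fun z => (norm_torusChar d m n z).le)

theorem stdAddChar_intCast_eq_exp (d : ℕ) [NeZero d] (k : ℤ) :
    (ZMod.stdAddChar (k : ZMod d) : ℂ) =
      Complex.exp (Complex.I * ((step d ^ 2 * k : ℝ) : ℂ)) := by
  have hd : (d : ℂ) ≠ 0 := Nat.cast_ne_zero.2 (NeZero.ne d)
  have h : (d : ℂ) * (step d : ℂ) ^ 2 = 2 * Real.pi := by exact_mod_cast mul_step_sq d
  rw [ZMod.stdAddChar_coe]
  congr 1
  push_cast
  rw [div_eq_iff hd]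
  linear_combination -(Complex.I * k) * h

/-- A character of the torus splits into a character of `ℤ / d × ℤ / d`, on the corners of the
cells, and its values on the syndrome cell. -/
theorem torusChar_add_cellCorner (d : ℕ) [NeZero d] (m n : ℤ) (a b : ZMod d) (z : ℝ × ℝ) :
    torusChar d m n (z + cellCorner d (a, b)) =
      ZMod.stdAddChar ((m : ZMod d) * a - (n : ZMod d) * b) * torusChar d m n z := by
  have h : ((m : ZMod d) * a - (n : ZMod d) * b) =
      ((m * (a.val : ℤ) - n * (b.val : ℤ) : ℤ) : ZMod d) := by
    push_cast
    simp
  rw [h, stdAddChar_intCast_eq_exp, torusChar, torusChar, ← Complex.exp_add]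
  congr 1
  simp only [cellCorner, Prod.fst_add, Prod.snd_add]
  push_cast
  ring

theorem integrableOn_grossWigner {d : ℕ} [NeZero d] {M : ℝ × ℝ → Matrix (ZMod d) (ZMod d) ℂ}
    {s : Set (ℝ × ℝ)} (hM : ∀ j k, IntegrableOn (fun z => M z j k) s) (a b : ZMod d) :
    IntegrableOn (fun z => grossWigner d (M z) a b) s := by
  simp only [grossWigner_eq_sum]
  exact integrable_finsetSum _ fun k _ => (hM _ _).const_mul _

theorem integrableOn_torusFun {d : ℕ} [NeZero d] {w : ZMod d → ZMod d → ℝ × ℝ → ℂ}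
    (hw : ∀ a b, IntegrableOn (w a b) (syndromeCell d)) :
    IntegrableOn (torusFun d w) (phaseTorus d) := by
  rw [integrableOn_phaseTorus_iff]
  rintro ⟨a, b⟩
  exact (hw a b).congr_fun (fun z hz => (torusFun_add_cellCorner d w a b hz).symm)
    (measurableSet_syndromeCell d)

/-- If a torus function is, on the translate by `(a ℓ, b ℓ)`, the Gross Wigner function at `(a, b)`
of a matrix-valued function `M` on the syndrome cell, then its Fourier coefficients are integrals of
the diagonals of `M`. -/
theorem setIntegral_torusChar_mul_torusFun {d : ℕ} [NeZero d] (hd : Odd d)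
    {M : ℝ × ℝ → Matrix (ZMod d) (ZMod d) ℂ}
    (hM : ∀ j k, IntegrableOn (fun z => M z j k) (syndromeCell d)) (m n : ℤ) :
    ∫ z in phaseTorus d,
        torusChar d m n z * torusFun d (fun a b z => grossWigner d (M z) a b) z =
      d * ZMod.stdAddChar ((m : ZMod d) * (n : ZMod d) * halfMod d) *
        ∑ k : ZMod d, ZMod.stdAddChar ((m : ZMod d) * k) *
          ∫ z in syndromeCell d, torusChar d m n z * M z k (k + n) := by
  have hW : ∀ a b : ZMod d, IntegrableOn (fun z =>
      ZMod.stdAddChar ((m : ZMod d) * a - (n : ZMod d) * b) *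
      (torusChar d m n z * grossWigner d (M z) a b)) (syndromeCell d) := fun a b =>
    (integrable_torusChar_mul m n (integrableOn_grossWigner hM a b)).const_mul _
  have hpt : ∀ a b : ZMod d, EqOn (fun z => torusChar d m n (z + cellCorner d (a, b)) *
      torusFun d (fun a b z => grossWigner d (M z) a b) (z + cellCorner d (a, b)))
      (fun z => ZMod.stdAddChar ((m : ZMod d) * a - (n : ZMod d) * b) *
        (torusChar d m n z * grossWigner d (M z) a b)) (syndromeCell d) := by
    intro a b z hz
    simp only
    rw [torusFun_add_cellCorner d _ a b hz, torusChar_add_cellCorner, mul_assoc]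
  rw [setIntegral_phaseTorus]
  · rw [Finset.sum_congr rfl fun a _ => Finset.sum_congr rfl fun b _ =>
      setIntegral_congr_fun (measurableSet_syndromeCell d) (hpt a b)]
    have hint : ∀ k : ZMod d, IntegrableOn (fun z => ZMod.stdAddChar ((m : ZMod d) * k) *
        (torusChar d m n z * M z k (k + n))) (syndromeCell d) := fun k =>
      (integrable_torusChar_mul m n (hM _ _)).const_mul _
    have hR : ∑ k : ZMod d, ZMod.stdAddChar ((m : ZMod d) * k) *
        ∫ z in syndromeCell d, torusChar d m n z * M z k (k + n) =
        ∫ z in syndromeCell d, ∑ k : ZMod d, ZMod.stdAddChar ((m : ZMod d) * k) *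
          (torusChar d m n z * M z k (k + n)) := by
      rw [integral_finsetSum _ fun k _ => hint k]
      exact Finset.sum_congr rfl fun k _ => (integral_const_mul _ _).symm
    rw [hR, ← integral_const_mul]
    rw [Finset.sum_congr rfl fun a _ => (integral_finsetSum _ fun b _ => hW a b).symm,
      ← integral_finsetSum _ fun a _ => integrable_finsetSum _ fun b _ => hW a b]
    refine integral_congr_ae (Filter.Eventually.of_forall fun z => ?_)
    have h := sum_stdAddChar_mul_grossWigner d hd (M z) m n
    calc ∑ a : ZMod d, ∑ b : ZMod d, ZMod.stdAddChar ((m : ZMod d) * a - (n : ZMod d) * b) *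
          (torusChar d m n z * grossWigner d (M z) a b)
        = torusChar d m n z * ∑ a : ZMod d, ∑ b : ZMod d,
          ZMod.stdAddChar ((m : ZMod d) * a - (n : ZMod d) * b) * grossWigner d (M z) a b := by
          simp only [Finset.mul_sum]
          exact Finset.sum_congr rfl fun a _ => Finset.sum_congr rfl fun b _ => by ring
      _ = _ := by
          rw [h]
          simp only [Finset.mul_sum]
          exact Finset.sum_congr rfl fun a _ => by ring
  · rintro ⟨a, b⟩
    exact (hW a b).congr_fun (fun z hz => (hpt a b hz).symm) (measurableSet_syndromeCell d)

/-! ### Uniqueness of Fourier coefficients on the torus -/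

/-- The quotient map from the plane to the standard torus that identifies points modulo `d ℓ`. -/
def toUnitTorus (d : ℕ) (z : ℝ × ℝ) : UnitAddTorus (Fin 2) :=
  ![((z.1 / (d * step d) : ℝ) : UnitAddCircle), ((z.2 / (d * step d) : ℝ) : UnitAddCircle)]

theorem continuous_toUnitTorus (d : ℕ) : Continuous (toUnitTorus d) := by
  refine continuous_pi fun i => ?_
  fin_cases i
  · exact (AddCircle.continuous_mk' 1).comp (continuous_fst.div_const _)
  · exact (AddCircle.continuous_mk' 1).comp (continuous_snd.div_const _)

theorem mul_step_pos (d : ℕ) [NeZero d] : 0 < d * step d :=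
  mul_pos (Nat.cast_pos.2 (NeZero.pos d)) (step_pos d)

theorem coe_div_injOn_Ico {L : ℝ} (hL : 0 < L) :
    InjOn (fun u : ℝ => ((u / L : ℝ) : UnitAddCircle)) (Ico 0 L) := by
  intro u hu v hv h
  have key : ∀ w ∈ Ico 0 L, w / L ∈ Ico (0 : ℝ) (0 + 1) := fun w hw =>
    ⟨div_nonneg hw.1 hL.le, by rw [zero_add, div_lt_one hL]; exact hw.2⟩
  have h2 := (AddCircle.coe_eq_coe_iff_of_mem_Ico (key u hu) (key v hv)).1 h
  exact (div_left_inj' hL.ne').1 h2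

theorem injOn_toUnitTorus (d : ℕ) [NeZero d] : InjOn (toUnitTorus d) (phaseTorus d) := by
  intro z hz w hw h
  refine Prod.ext ?_ ?_
  · exact coe_div_injOn_Ico (mul_step_pos d) hz.1 hw.1 (congrFun h 0)
  · exact coe_div_injOn_Ico (mul_step_pos d) hz.2 hw.2 (congrFun h 1)

theorem mFourier_toUnitTorus (d : ℕ) [NeZero d] (k : Fin 2 → ℤ) (z : ℝ × ℝ) :
    UnitAddTorus.mFourier k (toUnitTorus d z) = torusChar d (k 0) (-k 1) z := by
  have hL : ((d * step d : ℝ) : ℂ) ≠ 0 := Complex.ofReal_ne_zero.2 (mul_step_pos d).ne'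
  have h : (d : ℂ) * (step d : ℂ) ^ 2 = 2 * Real.pi := by exact_mod_cast mul_step_sq d
  rw [UnitAddTorus.mFourier, ContinuousMap.coe_mk, Fin.prod_univ_two, toUnitTorus]
  simp only [Matrix.cons_val_zero, Matrix.cons_val_one]
  rw [fourier_coe_apply, fourier_coe_apply, ← Complex.exp_add, torusChar]
  congr 1
  push_cast at hL ⊢
  rw [← h]
  have h1 : (d : ℂ) ≠ 0 := left_ne_zero_of_mul hL
  have h2 : (step d : ℂ) ≠ 0 := right_ne_zero_of_mul hL
  field_simp
  ring

/-- Pairing with an integrable function on the torus is a continuous functional on the continuous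
functions, so it vanishes if it vanishes on trigonometric polynomials. -/
theorem setIntegral_comp_toUnitTorus_mul_eq_zero {d : ℕ} [NeZero d] {F : ℝ × ℝ → ℂ}
    (hF : IntegrableOn F (phaseTorus d))
    (h0 : ∀ m n : ℤ, ∫ z in phaseTorus d, torusChar d m n z * F z = 0)
    (g : C(UnitAddTorus (Fin 2), ℂ)) :
    ∫ z in phaseTorus d, g (toUnitTorus d z) * F z = 0 := by
  have hint : ∀ g : C(UnitAddTorus (Fin 2), ℂ),
      IntegrableOn (fun z => g (toUnitTorus d z) * F z) (phaseTorus d) := fun g =>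
    hF.bdd_mul (c := ‖g‖) (g.continuous.comp (continuous_toUnitTorus d)).aestronglyMeasurable
      (Filter.Eventually.of_forall fun z => g.norm_coe_le_norm _)
  let Φ : C(UnitAddTorus (Fin 2), ℂ) →L[ℂ] ℂ := LinearMap.mkContinuous
    { toFun := fun g => ∫ z in phaseTorus d, g (toUnitTorus d z) * F z
      map_add' := fun g g' => by
        rw [← integral_add (hint g) (hint g')]
        simp only [ContinuousMap.add_apply, add_mul]
      map_smul' := fun c g => by
        rw [RingHom.id_apply, smul_eq_mul, ← integral_const_mul]
        simp only [ContinuousMap.smul_apply, smul_eq_mul, mul_assoc] }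
    (∫ z in phaseTorus d, ‖F z‖) fun g => by
      rw [mul_comm, ← integral_const_mul]
      refine norm_integral_le_of_norm_le (hF.norm.const_mul _)
        (Filter.Eventually.of_forall fun z => ?_)
      rw [norm_mul]
      exact mul_le_mul_of_nonneg_right (g.norm_coe_le_norm _) (norm_nonneg _)
  have hspan : Submodule.span ℂ (range UnitAddTorus.mFourier) ≤ LinearMap.ker Φ.toLinearMap := by
    refine Submodule.span_le.2 ?_
    rintro _ ⟨k, rfl⟩
    change ∫ z in phaseTorus d, UnitAddTorus.mFourier k (toUnitTorus d z) * F z = 0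
    simp only [mFourier_toUnitTorus]
    exact h0 _ _
  have htop := Submodule.topologicalClosure_minimal _ hspan Φ.isClosed_ker
  rw [UnitAddTorus.span_mFourier_closure_eq_top] at htop
  exact htop (Submodule.mem_top : g ∈ ⊤)

/-- Continuous functions on the torus decrease to the indicator function of a compact set. A compact
set in the half-open square `[0, d ℓ)²` is the preimage of its image in the torus, since the
quotient map is injective there. -/
theorem setIntegral_isCompact_eq_zero_of_fourier {d : ℕ} [NeZero d] {F : ℝ × ℝ → ℂ}
    (hF : IntegrableOn F (phaseTorus d))
    (h0 : ∀ m n : ℤ, ∫ z in phaseTorus d, torusChar d m n z * F z = 0)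
    {K : Set (ℝ × ℝ)} (hK : IsCompact K) (hKs : K ⊆ phaseTorus d) :
    ∫ z in K, F z = 0 := by
  have hT : MeasurableSet (phaseTorus d) := measurableSet_Ico.prod measurableSet_Ico
  have hcl : IsClosed (toUnitTorus d '' K) := (hK.image (continuous_toUnitTorus d)).isClosed
  have hpos : ∀ n : ℕ, (0 : ℝ) < 1 / ((n : ℝ) + 1) := fun n => Nat.one_div_pos_of_nat
  -- continuous functions decreasing to the indicator of the image of `K`
  let φ : ℕ → UnitAddTorus (Fin 2) → ℂ := fun n x =>
    ((thickenedIndicator (hpos n) (toUnitTorus d '' K) x : ℝ) : ℂ)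
  have hφc : ∀ n, Continuous (φ n) := fun n => Complex.continuous_ofReal.comp
    (NNReal.continuous_coe.comp (thickenedIndicator (hpos n) (toUnitTorus d '' K)).continuous)
  have hφ1 : ∀ n x, ‖φ n x‖ ≤ 1 := fun n x => by
    simp only [φ, Complex.norm_real, NNReal.norm_eq]
    exact_mod_cast thickenedIndicator_le_one (hpos n) (toUnitTorus d '' K) x
  have hlim : ∀ z ∈ phaseTorus d, Filter.Tendsto (fun n => φ n (toUnitTorus d z) * F z)
      Filter.atTop (nhds (K.indicator F z)) := by
    intro z hz
    have h1 := tendsto_pi_nhds.1 (thickenedIndicator_tendsto_indicator_closure hpos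
      tendsto_one_div_add_atTop_nhds_zero_nat (toUnitTorus d '' K)) (toUnitTorus d z)
    rw [hcl.closure_eq] at h1
    have h2 := ((Complex.continuous_ofReal.comp NNReal.continuous_coe).tendsto _).comp h1
    have h3 := h2.mul_const (F z)
    refine h3.trans_eq ?_
    congr 1
    by_cases hzK : z ∈ K
    · rw [indicator_of_mem (mem_image_of_mem _ hzK), indicator_of_mem hzK]
      simp
    · have : toUnitTorus d z ∉ toUnitTorus d '' K := by
        rintro ⟨w, hw, hwz⟩
        exact hzK (injOn_toUnitTorus d (hKs hw) hz hwz ▸ hw)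
      simp [hzK, this]
  have hconv := tendsto_integral_of_dominated_convergence (μ := volume.restrict (phaseTorus d))
    (F := fun n z => φ n (toUnitTorus d z) * F z) (f := K.indicator F) (fun z => ‖F z‖)
    (fun n => ((hφc n).comp (continuous_toUnitTorus d)).aestronglyMeasurable.mul hF.1) hF.norm
    (fun n => Filter.Eventually.of_forall fun z => by
      rw [norm_mul]
      exact mul_le_of_le_one_left (norm_nonneg _) (hφ1 n _))
    ((ae_restrict_iff' hT).2 (Filter.Eventually.of_forall hlim))
  have hz : ∀ n, ∫ z in phaseTorus d, φ n (toUnitTorus d z) * F z = 0 := fun n =>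
    setIntegral_comp_toUnitTorus_mul_eq_zero hF h0 ⟨φ n, hφc n⟩
  simp only [hz] at hconv
  have h := tendsto_nhds_unique tendsto_const_nhds hconv
  rw [integral_indicator hK.measurableSet, Measure.restrict_restrict hK.measurableSet,
    inter_eq_left.2 hKs] at h
  exact h.symm

theorem ae_eq_zero_of_fourier {d : ℕ} [NeZero d] {F : ℝ × ℝ → ℂ}
    (hF : IntegrableOn F (phaseTorus d))
    (h0 : ∀ m n : ℤ, ∫ z in phaseTorus d, torusChar d m n z * F z = 0) :
    F =ᵐ[volume.restrict (phaseTorus d)] 0 := by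
  set L := d * step d with hL
  have hLpos : 0 < L := mul_step_pos d
  -- exhaustion of the half-open square by compact squares
  let S : ℕ → Set (ℝ × ℝ) := fun n =>
    Icc 0 (L - 1 / ((n : ℝ) + 1)) ×ˢ Icc 0 (L - 1 / ((n : ℝ) + 1))
  have hSc : ∀ n, IsCompact (S n) := fun n => isCompact_Icc.prod isCompact_Icc
  have hSI : ∀ n : ℕ, Icc 0 (L - 1 / ((n : ℝ) + 1)) ⊆ Ico 0 L := fun n =>
    Icc_subset_Ico_right (sub_lt_self _ Nat.one_div_pos_of_nat)
  have hSs : ∀ n, S n ⊆ phaseTorus d := fun n => prod_mono (hSI n) (hSI n)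
  have hU : phaseTorus d = ⋃ n, S n := by
    refine Subset.antisymm (fun z hz => ?_) (iUnion_subset hSs)
    have hm : 0 < L - max z.1 z.2 := sub_pos.2 (max_lt hz.1.2 hz.2.2)
    obtain ⟨n, hn⟩ := exists_nat_one_div_lt hm
    refine mem_iUnion.2 ⟨n, ⟨hz.1.1, ?_⟩, ⟨hz.2.1, ?_⟩⟩
    · linarith [le_max_left z.1 z.2]
    · linarith [le_max_right z.1 z.2]
  rw [hU]
  refine (ae_restrict_iUnion_iff _ _).2 fun n => ?_
  refine ae_eq_zero_of_forall_setIntegral_isCompact_eq_zero (hF.mono_set (hSs n)) fun K hK => ?_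
  rw [Measure.restrict_restrict hK.measurableSet]
  exact setIntegral_isCompact_eq_zero_of_fourier hF h0 (hK.inter (hSc n))
    (inter_subset_right.trans (hSs n))

/-! ### The Zak transform: summability and Parseval's identity -/

/-- The measure on syndromes: Lebesgue measure on the cell `[0, ℓ) × [0, ℓ)`. -/
abbrev cellMeasure (d : ℕ) : Measure (ℝ × ℝ) := volume.restrict (syndromeCell d)

theorem cellMeasure_eq_prod (d : ℕ) :
    cellMeasure d = (volume.restrict (Ico 0 (step d))).prod (volume.restrict (Ico 0 (step d))) := by
  rw [Measure.prod_restrict]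
  rfl

/-- The `n`-th term of the comb series as an element of `L²` of the syndrome cell. -/
def combVec (d : ℕ) (j : ZMod d) (ψ : CVSpace) (n : ℤ) : Lp ℂ 2 (cellMeasure d) :=
  (memLp_combTerm d j ψ n).toLp

/-- The position `j ℓ + n d ℓ` of a tooth of the comb of the `j`-th code word. -/
def tooth (d : ℕ) (j : ZMod d) (n : ℤ) : ℝ := j.val * step d + n * (d * step d)

/-- The interval of length `ℓ` to the right of a tooth. -/
def toothInterval (d : ℕ) (q : ZMod d × ℤ) : Set ℝ :=
  (fun y => y - tooth d q.1 q.2) ⁻¹' Ico 0 (step d)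

theorem measurableSet_toothInterval (d : ℕ) (q : ZMod d × ℤ) :
    MeasurableSet (toothInterval d q) :=
  (measurable_id.sub_const _) measurableSet_Ico

theorem mem_toothInterval_iff (d : ℕ) [NeZero d] (q : ZMod d × ℤ) (y : ℝ) :
    y ∈ toothInterval d q ↔ ⌊y / step d⌋ = q.1.val + q.2 * d := by
  rw [floor_div_step_eq_iff, toothInterval, mem_preimage, tooth]
  push_cast
  rw [add_mul, mul_assoc]

theorem pairwise_disjoint_toothInterval (d : ℕ) [NeZero d] :
    Pairwise (Function.onFun Disjoint (toothInterval d)) := by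
  intro q r hqr
  refine Set.disjoint_left.2 fun y hq hr => hqr ?_
  rw [mem_toothInterval_iff] at hq hr
  have h := hq.symm.trans hr
  have h1 : q.1 = r.1 := by
    have := congrArg (Int.cast : ℤ → ZMod d) h
    push_cast at this
    simpa using this
  refine Prod.ext h1 ?_
  rw [h1] at h
  have hd : (d : ℤ) ≠ 0 := Nat.cast_ne_zero.2 (NeZero.ne d)
  exact mul_right_cancel₀ hd (add_left_cancel h)

theorem exists_val_add_mul (d : ℕ) [NeZero d] {p : ℤ} {k : ZMod d} (h : (p : ZMod d) = k) :
    ∃ e : ℤ, p = k.val + e * d := by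
  have h1 : ((k.val : ℤ) : ZMod d) = (p : ZMod d) := by
    push_cast
    rw [h]
    simp
  obtain ⟨e, he⟩ := (ZMod.intCast_eq_intCast_iff_dvd_sub _ _ _).1 h1
  exact ⟨e, by linear_combination he⟩

theorem iUnion_toothInterval (d : ℕ) [NeZero d] : ⋃ q, toothInterval d q = univ := by
  refine eq_univ_of_forall fun y => mem_iUnion.2 ?_
  obtain ⟨e, he⟩ := exists_val_add_mul d (p := ⌊y / step d⌋) rfl
  exact ⟨(_, e), (mem_toothInterval_iff d _ y).2 he⟩

theorem setIntegral_toothInterval (d : ℕ) (q : ZMod d × ℤ) (F : ℝ → ℂ) :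
    ∫ y in toothInterval d q, F y = ∫ s in Ico 0 (step d), F (s + tooth d q.1 q.2) := by
  have hmp := (measurePreserving_add_right (volume : Measure ℝ)
    (tooth d q.1 q.2)).restrict_preimage (measurableSet_toothInterval d q)
  have e : (fun s => s + tooth d q.1 q.2) ⁻¹' toothInterval d q = Ico 0 (step d) := by
    ext s
    simp [toothInterval]
  rw [e] at hmp
  exact (hmp.integral_comp (measurableEmbedding_addRight _) F).symm

theorem integral_exp_step (d : ℕ) [NeZero d] (n : ℤ) :
    ∫ t in Ico 0 (step d), Complex.exp (Complex.I * ((t * (n * (d * step d)) : ℝ) : ℂ)) =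
      if n = 0 then (step d : ℂ) else 0 := by
  split_ifs with hn
  · subst hn
    simp [(step_pos d).le]
  · have hL : ((d * step d : ℝ) : ℂ) ≠ 0 := Complex.ofReal_ne_zero.2 (mul_step_pos d).ne'
    have h : (d : ℂ) * (step d : ℂ) ^ 2 = 2 * Real.pi := by exact_mod_cast mul_step_sq d
    have hc : Complex.I * (n * (d * step d : ℝ)) ≠ 0 :=
      mul_ne_zero Complex.I_ne_zero (mul_ne_zero (Int.cast_ne_zero.2 hn) hL)
    rw [integral_Ico_eq_integral_Ioc, ← intervalIntegral.integral_of_le (step_pos d).le]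
    have e : ∀ t : ℝ, Complex.exp (Complex.I * ((t * (n * (d * step d)) : ℝ) : ℂ)) =
        Complex.exp (Complex.I * (n * (d * step d : ℝ)) * t) := fun t => by
      congr 1
      push_cast
      ring
    simp only [e]
    rw [integral_exp_mul_complex hc]
    have e2 : Complex.I * (n * (d * step d : ℝ)) * (step d : ℝ) =
        n * (2 * Real.pi * Complex.I) := by
      push_cast
      linear_combination Complex.I * n * h
    rw [e2, Complex.exp_int_mul_two_pi_mul_I]
    simp

theorem star_exp_I_mul_ofReal (x : ℝ) :
    star (Complex.exp (Complex.I * (x : ℂ))) = Complex.exp (Complex.I * ((-x : ℝ) : ℂ)) := by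
  rw [Complex.star_def, ← Complex.exp_conj, map_mul, Complex.conj_I, Complex.conj_ofReal]
  congr 1
  push_cast
  ring

theorem combTerm_eq (d : ℕ) (j : ZMod d) (ψ : CVSpace) (n : ℤ) (z : ℝ × ℝ) :
    combTerm d j ψ n z = ((1 / Real.sqrt (step d) : ℝ) : ℂ) *
      (Complex.exp (Complex.I * ((-z.2 * (tooth d j n + z.1 / 2) : ℝ) : ℂ)) *
        ψ (z.1 + tooth d j n)) := by
  rw [combTerm, displaceFun, tooth, sub_neg_eq_add, add_comm z.1, neg_div, sub_neg_eq_add]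

theorem combTerm_mul_star_combTerm (d : ℕ) [NeZero d] (j : ZMod d) (φ ψ : CVSpace) (n n' : ℤ)
    (z : ℝ × ℝ) :
    combTerm d j ψ n z * star (combTerm d j φ n' z) =
      (ψ (z.1 + tooth d j n) * star (φ (z.1 + tooth d j n'))) *
        (((step d)⁻¹ : ℝ) *
          Complex.exp (Complex.I * ((z.2 * ((n' - n : ℤ) * (d * step d)) : ℝ) : ℂ))) := by
  have hs : ((1 / Real.sqrt (step d) : ℝ) : ℂ) * ((1 / Real.sqrt (step d) : ℝ) : ℂ) =
      ((step d)⁻¹ : ℝ) := by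
    rw [← Complex.ofReal_mul, div_mul_div_comm, one_mul, Real.mul_self_sqrt (step_pos d).le,
      one_div]
  have hst : ∀ x : ℝ, star (x : ℂ) = x := Complex.conj_ofReal
  simp only [combTerm_eq, star_mul', hst, star_exp_I_mul_ofReal]
  have he : Complex.exp (Complex.I * ((z.2 * ((n' - n : ℤ) * (d * step d)) : ℝ) : ℂ)) =
      Complex.exp (Complex.I * ((-z.2 * (tooth d j n + z.1 / 2) : ℝ) : ℂ)) *
      Complex.exp (Complex.I * ((-(-z.2 * (tooth d j n' + z.1 / 2)) : ℝ) : ℂ)) := by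
    rw [← Complex.exp_add]
    congr 1
    simp only [tooth]
    push_cast
    ring
  rw [he, ← hs]
  ring

/-- The terms of the comb series are orthogonal; the diagonal inner products are integrals over
disjoint intervals. -/
theorem inner_combVec (d : ℕ) [NeZero d] (j : ZMod d) (φ ψ : CVSpace) (n n' : ℤ) :
    inner ℂ (combVec d j φ n') (combVec d j ψ n) =
      if n' = n then ∫ y in toothInterval d (j, n), ψ y * star (φ y) else 0 := by
  have h1 : inner ℂ (combVec d j φ n') (combVec d j ψ n) =
      ∫ z, combTerm d j ψ n z * star (combTerm d j φ n' z) ∂cellMeasure d := by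
    rw [L2.inner_def]
    refine integral_congr_ae ?_
    filter_upwards [(memLp_combTerm d j φ n').coeFn_toLp, (memLp_combTerm d j ψ n).coeFn_toLp]
      with z h1 h2
    rw [combVec, combVec, h1, h2, RCLike.inner_apply]
    rfl
  rw [h1]
  simp only [combTerm_mul_star_combTerm]
  rw [cellMeasure_eq_prod, integral_prod_mul
    (fun s : ℝ => ψ (s + tooth d j n) * star (φ (s + tooth d j n'))) (fun t : ℝ =>
    ((step d)⁻¹ : ℝ) * Complex.exp (Complex.I * ((t * ((n' - n : ℤ) * (d * step d)) : ℝ) : ℂ))),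
    integral_const_mul, integral_exp_step]
  by_cases hn : n' = n
  · subst hn
    have hs : (step d : ℂ) ≠ 0 := Complex.ofReal_ne_zero.2 (step_pos d).ne'
    rw [if_pos (sub_self _), if_pos rfl, setIntegral_toothInterval]
    push_cast
    rw [inv_mul_cancel₀ hs, mul_one]
  · rw [if_neg (sub_ne_zero.2 hn), if_neg hn, mul_zero, mul_zero]

theorem integrable_mul_star (φ ψ : CVSpace) : Integrable (fun y => ψ y * star (φ y)) := by
  have h := L2.integrable_inner (𝕜 := ℂ) φ ψ
  simp only [RCLike.inner_apply] at h
  exact h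

theorem hasSum_toothInterval (d : ℕ) [NeZero d] (φ ψ : CVSpace) :
    HasSum (fun q => ∫ y in toothInterval d q, ψ y * star (φ y)) (inner ℂ φ ψ) := by
  have h := hasSum_integral_iUnion (μ := volume) (measurableSet_toothInterval d)
    (pairwise_disjoint_toothInterval d) (f := fun y => ψ y * star (φ y))
    (integrable_mul_star φ ψ).integrableOn
  rw [iUnion_toothInterval, setIntegral_univ] at h
  exact h

theorem summable_of_pairwise_orthogonal {ι E : Type*} [NormedAddCommGroup E]
    [InnerProductSpace ℂ E] [CompleteSpace E] {v : ι → E}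
    (ho : ∀ i j, i ≠ j → inner ℂ (v i) (v j) = 0) (hs : Summable fun i => ‖v i‖ ^ 2) :
    Summable v := by
  have hO : OrthogonalFamily ℂ (fun i => ↥(Submodule.span ℂ {v i}))
      fun i => (Submodule.span ℂ {v i}).subtypeₗᵢ := by
    refine OrthogonalFamily.of_pairwise fun i j hij => ?_
    rw [Function.onFun, Submodule.isOrtho_span]
    rintro _ rfl _ rfl
    exact ho i j hij
  exact (hO.summable_iff_norm_sq_summable fun i =>
    ⟨v i, Submodule.mem_span_singleton_self _⟩).2 hs

theorem hasSum_combVec (d : ℕ) [NeZero d] (j : ZMod d) (ψ : CVSpace) :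
    HasSum (combVec d j ψ) (codeAmplitude d j ψ) := by
  have hs : Summable (combVec d j ψ) := by
    refine summable_of_pairwise_orthogonal (fun n n' hn => ?_) ?_
    · rw [inner_combVec, if_neg hn]
    · have h1 : Summable fun n : ℤ => ∫ y in toothInterval d (j, n), ψ y * star (ψ y) :=
        (hasSum_toothInterval d ψ ψ).summable.comp_injective (Prod.mk_right_injective j)
      refine (Complex.reCLM.summable h1).congr fun n => ?_
      rw [← inner_self_eq_norm_sq (𝕜 := ℂ), inner_combVec, if_pos rfl]
      rfl
  exact hs.hasSum

theorem hasSum_inner_codeAmplitude (d : ℕ) [NeZero d] (j : ZMod d) (φ ψ : CVSpace) :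
    HasSum (fun n => ∫ y in toothInterval d (j, n), ψ y * star (φ y))
      (inner ℂ (codeAmplitude d j φ) (codeAmplitude d j ψ)) := by
  have h := (hasSum_combVec d j ψ).mapL (innerSL ℂ (codeAmplitude d j φ))
  refine h.congr_fun fun n => ?_
  -- only the `n`-th term of the other comb series contributes
  have h2 := ((hasSum_combVec d j φ).mapL (innerSL ℂ (combVec d j ψ n))).star
  have h3 := hasSum_single n (f := fun n' => star (innerSL ℂ (combVec d j ψ n)
    (combVec d j φ n'))) fun n' hn' => by
      rw [innerSL_apply_apply, inner_combVec, if_neg hn'.symm, star_zero]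
  have h4 := h2.unique h3
  rw [innerSL_apply_apply, innerSL_apply_apply, ← starRingEnd_apply, ← starRingEnd_apply,
    inner_conj_symm, inner_conj_symm, inner_combVec, if_pos rfl] at h4
  rw [innerSL_apply_apply, h4]

/-- Parseval's identity: the `d` code amplitudes together form an isometry on `L²(ℝ)`. -/
theorem sum_inner_codeAmplitude (d : ℕ) [NeZero d] (φ ψ : CVSpace) :
    ∑ j, inner ℂ (codeAmplitude d j φ) (codeAmplitude d j ψ) = inner ℂ φ ψ :=
  (hasSum_fintype _).unique ((hasSum_toothInterval d φ ψ).prod_fiberwise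
    fun j => hasSum_inner_codeAmplitude d j φ ψ)

theorem sum_norm_sq_codeAmplitude (d : ℕ) [NeZero d] (ψ : CVSpace) :
    ∑ j, ‖codeAmplitude d j ψ‖ ^ 2 = ‖ψ‖ ^ 2 := by
  have h := sum_inner_codeAmplitude d ψ ψ
  simp only [inner_self_eq_norm_sq_to_K] at h
  exact_mod_cast h

/-! ### Lattice displacements act diagonally on the syndrome -/

theorem memLp_torusChar_mul (d : ℕ) (m n : ℤ) (f : Lp ℂ 2 (cellMeasure d)) :
    MemLp (fun z => torusChar d m n z * f z) 2 (cellMeasure d) := by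
  refine (Lp.memLp f).of_le ((continuous_torusChar d m n).aestronglyMeasurable.mul
    (Lp.aestronglyMeasurable f)) (Filter.Eventually.of_forall fun z => ?_)
  rw [norm_mul, norm_torusChar, one_mul]

/-- Multiplication by the character `exp(-i ℓ (n t - m s))` on `L²` of the syndrome cell. -/
def torusCharMul (d : ℕ) (m n : ℤ) : Lp ℂ 2 (cellMeasure d) →L[ℂ] Lp ℂ 2 (cellMeasure d) :=
  LinearIsometry.toContinuousLinearMap
    { toFun := fun f => (memLp_torusChar_mul d m n f).toLp
      map_add' := by
        intro f g
        rw [← MemLp.toLp_add]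
        refine MemLp.toLp_congr _ _ ?_
        filter_upwards [Lp.coeFn_add f g] with z hz
        rw [hz, Pi.add_apply, Pi.add_apply, mul_add]
      map_smul' := by
        intro c f
        rw [RingHom.id_apply, ← MemLp.toLp_const_smul]
        refine MemLp.toLp_congr _ _ ?_
        filter_upwards [Lp.coeFn_smul c f] with z hz
        rw [hz, Pi.smul_apply, Pi.smul_apply, smul_eq_mul, smul_eq_mul]
        ring
      norm_map' := by
        intro f
        change ‖(memLp_torusChar_mul d m n f).toLp‖ = ‖f‖
        rw [Lp.norm_toLp, Lp.norm_def]
        congr 1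
        refine eLpNorm_congr_norm_ae (Filter.Eventually.of_forall fun z => ?_)
        rw [norm_mul, norm_torusChar, one_mul] }

theorem coeFn_torusCharMul (d : ℕ) (m n : ℤ) (f : Lp ℂ 2 (cellMeasure d)) :
    torusCharMul d m n f =ᵐ[cellMeasure d] fun z => torusChar d m n z * f z :=
  (memLp_torusChar_mul d m n f).coeFn_toLp

theorem coeFn_displacement (x p : ℝ) (ψ : CVSpace) :
    displacement x p ψ =ᵐ[volume] displaceFun x p ψ :=
  (memLp_displaceFun x p ψ).coeFn_toLp

/-- The phase `exp(-i m n ℓ² / 2)` from reordering a lattice displacement. -/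
def latticePhase (d : ℕ) (m n : ℤ) : ℂ :=
  Complex.exp (Complex.I * ((-(m * n * step d ^ 2 / 2) : ℝ) : ℂ))

theorem combVec_displacement (d : ℕ) [NeZero d] (k : ZMod d) (ψ : CVSpace) (m n : ℤ)
    {j j' : ℤ} (hj : (k.val : ℤ) + j * d - n = (k - n : ZMod d).val + j' * d) :
    combVec d k (displacement (n * step d) (m * step d) ψ) j =
      (ZMod.stdAddChar ((m : ZMod d) * k) * latticePhase d m n) •
        torusCharMul d m n (combVec d (k - n) ψ j') := by
  have hae : ∀ᵐ z ∂cellMeasure d,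
      displacement (n * step d) (m * step d) ψ (z.1 + tooth d k j) =
        displaceFun (n * step d) (m * step d) ψ (z.1 + tooth d k j) := by
    rw [cellMeasure_eq_prod]
    have h1 := (measurePreserving_add_right volume (tooth d k j)).quasiMeasurePreserving.ae
      (coeFn_displacement (n * step d) (m * step d) ψ)
    exact Measure.quasiMeasurePreserving_fst.ae (ae_restrict_of_ae h1)
  have hk : (ZMod.stdAddChar ((m : ZMod d) * k) : ℂ) =
      Complex.exp (Complex.I * ((step d ^ 2 * (m * (k.val + j * d)) : ℝ) : ℂ)) := by
    have : (m : ZMod d) * k = ((m * (k.val + j * d) : ℤ) : ZMod d) := by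
      push_cast
      simp
    rw [this, stdAddChar_intCast_eq_exp]
    push_cast
    rfl
  have ht : tooth d k j - n * step d = tooth d (k - n) j' := by
    have h := congrArg (fun p : ℤ => (p : ℝ) * step d) hj
    push_cast at h
    rw [tooth, tooth]
    linear_combination h
  have hsub : ∀ s : ℝ, s + tooth d k j - n * step d = s + tooth d (k - n) j' := fun s => by
    rw [add_sub_assoc, ht]
  refine Lp.ext ?_
  refine (memLp_combTerm d k _ j).coeFn_toLp.trans (Filter.EventuallyEq.symm ?_)
  refine (Lp.coeFn_smul _ _).trans ?_
  filter_upwards [coeFn_torusCharMul d m n (combVec d (k - n) ψ j'),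
    (memLp_combTerm d (k - n) ψ j').coeFn_toLp, hae] with z h1 h2 h3
  rw [Pi.smul_apply, h1, combVec, h2, combTerm_eq, combTerm_eq, h3, displaceFun, hsub,
    smul_eq_mul]
  have he : Complex.exp (Complex.I * ((-z.2 * (tooth d k j + z.1 / 2) : ℝ) : ℂ)) *
      Complex.exp (Complex.I *
        ((m * step d * (z.1 + tooth d k j - n * step d / 2) : ℝ) : ℂ)) =
      ZMod.stdAddChar ((m : ZMod d) * k) * latticePhase d m n * torusChar d m n z *
        Complex.exp (Complex.I * ((-z.2 * (tooth d (k - n) j' + z.1 / 2) : ℝ) : ℂ)) := by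
    rw [hk, latticePhase, torusChar, ← ht, ← Complex.exp_add, ← Complex.exp_add,
      ← Complex.exp_add, ← Complex.exp_add]
    congr 1
    simp only [tooth]
    push_cast
    ring
  linear_combination -(((1 / Real.sqrt (step d) : ℝ) : ℂ) * ψ (z.1 + tooth d (k - n) j')) * he

/-- Displacement by a lattice vector permutes the code words up to phases, so on the amplitudes it
acts as multiplication by a character of the syndrome torus. -/
theorem codeAmplitude_displacement (d : ℕ) [NeZero d] (k : ZMod d) (ψ : CVSpace) (m n : ℤ) :
    codeAmplitude d k (displacement (n * step d) (m * step d) ψ) =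
      (ZMod.stdAddChar ((m : ZMod d) * k) * latticePhase d m n) •
        torusCharMul d m n (codeAmplitude d (k - n) ψ) := by
  obtain ⟨e, he⟩ := exists_val_add_mul d (p := (k.val : ℤ) - n) (k := k - n) (by push_cast; simp)
  refine (hasSum_combVec d k _).unique ?_
  have h := (((Equiv.addRight e).hasSum_iff.2 (hasSum_combVec d (k - n) ψ)).mapL
    (torusCharMul d m n)).const_smul (ZMod.stdAddChar ((m : ZMod d) * k) * latticePhase d m n)
  refine h.congr_fun fun j => ?_
  exact combVec_displacement d k ψ m n (j' := j + e) (by linear_combination he)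

/-- Since `(d + 1) / 2 - 1 / 2 = d / 2` and `d ℓ² = 2 π`, the product of the phases is
`exp(i m n d ℓ² / 2) = (-1) ^ (m n)`. -/
theorem stdAddChar_halfMod_mul_phase {d : ℕ} [NeZero d] (hd : Odd d) (m n : ℤ) :
    (ZMod.stdAddChar ((m : ZMod d) * (n : ZMod d) * halfMod d) : ℂ) *
      (ZMod.stdAddChar (-((m : ZMod d) * (n : ZMod d))) * (latticePhase d m n)⁻¹) =
        (-1) ^ (m * n) := by
  have h2 : (2 : ℂ) * ((d + 1) / 2 : ℕ) = d + 1 := by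
    have : 2 * ((d + 1) / 2) = d + 1 := by
      obtain ⟨k, rfl⟩ := hd
      omega
    exact_mod_cast this
  have h : (d : ℂ) * (step d : ℂ) ^ 2 = 2 * Real.pi := by exact_mod_cast mul_step_sq d
  have e1 : (m : ZMod d) * n * halfMod d = ((m * n * (((d + 1) / 2 : ℕ) : ℤ) : ℤ) : ZMod d) := by
    rw [halfMod, Int.cast_mul, Int.cast_mul, Int.cast_natCast]
  have e2 : -((m : ZMod d) * (n : ZMod d)) = ((-(m * n) : ℤ) : ZMod d) := by push_cast; rfl
  have e3 : (-1 : ℂ) ^ (m * n) = Complex.exp ((m * n : ℤ) * (Real.pi * Complex.I)) := by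
    rw [Complex.exp_int_mul, Complex.exp_pi_mul_I]
  rw [e1, e2, stdAddChar_intCast_eq_exp, stdAddChar_intCast_eq_exp, latticePhase, ← Complex.exp_neg,
    ← Complex.exp_add, ← Complex.exp_add, e3]
  congr 1
  generalize (d + 1) / 2 = q at h2 ⊢
  push_cast
  linear_combination (Complex.I * m * n * (step d : ℂ) ^ 2 / 2) * h2 + Complex.I * m * n / 2 * h

/-- The diagonals of the logical pure states have, as Fourier coefficients, the expectation values
of the lattice displacements. -/
theorem sum_setIntegral_codeAmplitude {d : ℕ} [NeZero d] (ψ : CVSpace) (m n : ℤ) :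
    ∑ k : ZMod d, ZMod.stdAddChar ((m : ZMod d) * k) * ∫ z in syndromeCell d, torusChar d m n z *
        (codeAmplitude d k ψ z * star (codeAmplitude d (k + n) ψ z)) =
      ZMod.stdAddChar (-((m : ZMod d) * (n : ZMod d))) * (latticePhase d m n)⁻¹ *
        inner ℂ ψ (displacement (n * step d) (m * step d) ψ) := by
  have hph : latticePhase d m n ≠ 0 := Complex.exp_ne_zero _
  rw [← sum_inner_codeAmplitude d, ← Equiv.sum_comp (Equiv.addRight (n : ZMod d))
    fun k => inner ℂ (codeAmplitude d k ψ)
      (codeAmplitude d k (displacement (n * step d) (m * step d) ψ)), Finset.mul_sum]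
  refine Finset.sum_congr rfl fun k _ => ?_
  simp only [Equiv.coe_addRight]
  rw [codeAmplitude_displacement, add_sub_cancel_right, inner_smul_right]
  have h1 : inner ℂ (codeAmplitude d (k + n) ψ) (torusCharMul d m n (codeAmplitude d k ψ)) =
      ∫ z in syndromeCell d, torusChar d m n z *
        (codeAmplitude d k ψ z * star (codeAmplitude d (k + n) ψ z)) := by
    rw [L2.inner_def]
    refine integral_congr_ae ?_
    filter_upwards [coeFn_torusCharMul d m n (codeAmplitude d k ψ)] with z hz
    rw [hz, RCLike.inner_apply, mul_assoc]
    rfl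
  rw [h1, mul_assoc, mul_assoc, mul_left_comm _ (latticePhase d m n), inv_mul_cancel_left₀ hph,
    ← mul_assoc, stdAddChar_mul]
  congr 2
  ring

/-! ### Traces against a density operator -/

instance countable_refIndex : Countable refIndex := by
  have : Fact ((2 : ℝ≥0∞) ≠ ∞) := ⟨by simp⟩
  -- distinct basis vectors are at distance `√2`, so small balls around them are disjoint
  refine Pairwise.countable_of_isOpen_disjoint (s := fun i => Metric.ball (refBasis i) (1 / 2))
    (fun i j hij => ?_) (fun i => Metric.isOpen_ball)
    fun i => ⟨_, Metric.mem_ball_self (by norm_num)⟩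
  refine Metric.ball_disjoint_ball ?_
  have h1 := @norm_sub_sq ℂ _ _ _ _ (refBasis i) (refBasis j)
  rw [refBasis.orthonormal.2 hij, refBasis.orthonormal.1, refBasis.orthonormal.1, map_zero] at h1
  rw [dist_eq_norm]
  nlinarith [norm_nonneg (refBasis i - refBasis j)]

section Trace

variable {ι H : Type*} [NormedAddCommGroup H] [InnerProductSpace ℂ H]

theorem HilbertBasis.hasSum_norm_sq_inner (b : HilbertBasis ι ℂ H) (x : H) :
    HasSum (fun i => ‖inner ℂ (b i) x‖ ^ 2) (‖x‖ ^ 2) := by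
  have h := (b.hasSum_inner_mul_inner x x).mapL Complex.reCLM
  rw [Complex.reCLM_apply, ← RCLike.re_eq_complex_re, inner_self_eq_norm_sq] at h
  refine h.congr_fun fun i => ?_
  rw [Complex.reCLM_apply, ← inner_conj_symm x, ← Complex.normSq_eq_conj_mul_self,
    Complex.ofReal_re, Complex.normSq_eq_norm_sq]

/-- Cyclicity of the trace `Tr[A S S] = Tr[S A S]`, for `S` self-adjoint and Hilbert–Schmidt. -/
theorem tsum_inner_mul_mul_self [CompleteSpace H] (b : HilbertBasis ι ℂ H) {S : H →L[ℂ] H}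
    (hS : ∀ x y, inner ℂ (S x) y = inner ℂ x (S y)) (hs : Summable fun i => ‖S (b i)‖ ^ 2)
    (A : H →L[ℂ] H) :
    ∑' i, inner ℂ (b i) (A (S (S (b i)))) = ∑' i, inner ℂ (S (b i)) (A (S (b i))) := by
  let f : ι × ι → ℂ := fun q => inner ℂ (S (b q.2)) (b q.1) * inner ℂ (b q.1) (A (S (b q.2)))
  have h1 : Summable fun q : ι × ι => ‖inner ℂ (b q.2) (S (b q.1))‖ ^ 2 := by
    rw [summable_prod_of_nonneg fun q => sq_nonneg _]
    refine ⟨fun j => (b.hasSum_norm_sq_inner (S (b j))).summable, ?_⟩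
    have e : ∀ j, ∑' i, ‖inner ℂ (b i) (S (b j))‖ ^ 2 = ‖S (b j)‖ ^ 2 := fun j =>
      (b.hasSum_norm_sq_inner (S (b j))).tsum_eq
    simp only [e]
    exact hs
  have h2 : Summable fun q : ι × ι => ‖inner ℂ (b q.2) (A (S (b q.1)))‖ ^ 2 := by
    rw [summable_prod_of_nonneg fun q => sq_nonneg _]
    refine ⟨fun j => (b.hasSum_norm_sq_inner (A (S (b j)))).summable, ?_⟩
    refine Summable.of_nonneg_of_le (fun j => tsum_nonneg fun i => sq_nonneg _) (fun j => ?_)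
      (hs.mul_left (‖A‖ ^ 2))
    rw [(b.hasSum_norm_sq_inner (A (S (b j)))).tsum_eq, ← mul_pow]
    exact pow_le_pow_left₀ (norm_nonneg _) (A.le_opNorm _) 2
  have hf : Summable (f ∘ Prod.swap) := by
    refine Summable.of_norm_bounded (h1.add h2) fun q => ?_
    simp only [f, Function.comp_apply, Prod.fst_swap, Prod.snd_swap]
    rw [norm_mul, norm_inner_symm (S (b q.1))]
    nlinarith [sq_nonneg (‖inner ℂ (b q.2) (S (b q.1))‖ - ‖inner ℂ (b q.2) (A (S (b q.1)))‖),
      sq_nonneg (‖inner ℂ (b q.2) (S (b q.1))‖), sq_nonneg ‖inner ℂ (b q.2) (A (S (b q.1)))‖]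
  have hf' : Summable f := (Equiv.prodComm ι ι).summable_iff.1 hf
  have hrow : ∀ i, HasSum (fun j => f (i, j)) (inner ℂ (b i) (A (S (S (b i))))) := by
    intro i
    have h := b.hasSum_inner_mul_inner (S (ContinuousLinearMap.adjoint A (b i))) (S (b i))
    rw [hS, ContinuousLinearMap.adjoint_inner_left] at h
    refine h.congr_fun fun j => ?_
    simp only [f]
    rw [hS (b j), hS (ContinuousLinearMap.adjoint A (b i)), ContinuousLinearMap.adjoint_inner_left,
      mul_comm]
  have hcol : ∀ j, HasSum (fun i => (f ∘ Prod.swap) (j, i)) (inner ℂ (S (b j)) (A (S (b j)))) :=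
    fun j => b.hasSum_inner_mul_inner (S (b j)) (A (S (b j)))
  rw [(hf'.hasSum.prod_fiberwise hrow).tsum_eq, (hf.hasSum.prod_fiberwise hcol).tsum_eq]
  exact ((Equiv.prodComm ι ι).tsum_eq f).symm

end Trace

theorem inner_opSqrt (ρ : CVSpace →L[ℂ] CVSpace) (x y : CVSpace) :
    inner ℂ (opSqrt ρ x) y = inner ℂ x (opSqrt ρ y) :=
  (opSqrt_isPositive ρ).isSymmetric x y

/-- The vectors `√ρ eᵢ` whose rank-one operators sum to the density operator `ρ`. -/
def stateVec (ρ : CVSpace →L[ℂ] CVSpace) (i : refIndex) : CVSpace := opSqrt ρ (refBasis i)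

theorem opSqrt_opSqrt {ρ : CVSpace →L[ℂ] CVSpace} (hρ : ρ.IsPositive) (x : CVSpace) :
    opSqrt ρ (opSqrt ρ x) = ρ x := by
  rw [← mul_apply_eq_comp, opSqrt_mul_self hρ]

theorem hasSum_norm_sq_stateVec {ρ : CVSpace →L[ℂ] CVSpace} (hρ : IsDensityOperator ρ) :
    HasSum (fun i => ‖stateVec ρ i‖ ^ 2) 1 := by
  have h := hρ.trace_one.mapL Complex.reCLM
  rw [Complex.reCLM_apply, Complex.one_re] at h
  refine h.congr_fun fun i => ?_
  rw [Complex.reCLM_apply, ← opSqrt_opSqrt hρ.pos, ← inner_opSqrt, stateVec,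
    ← inner_self_eq_norm_sq (𝕜 := ℂ)]
  rfl

theorem opTrace_mul_eq_tsum {ρ : CVSpace →L[ℂ] CVSpace} (hρ : IsDensityOperator ρ)
    (A : CVSpace →L[ℂ] CVSpace) :
    opTrace (A * ρ) = ∑' i, inner ℂ (stateVec ρ i) (A (stateVec ρ i)) := by
  refine Eq.trans ?_ (tsum_inner_mul_mul_self refBasis (inner_opSqrt ρ)
    (hasSum_norm_sq_stateVec hρ).summable A)
  rw [opTrace]
  refine tsum_congr fun i => ?_
  rw [mul_apply_eq_comp, opSqrt_opSqrt hρ.pos]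

/-! ### Series of integrable functions -/

section Series

variable {α ι : Type*} [MeasurableSpace α] {μ : Measure α} [Countable ι] {F : ι → α → ℂ}

theorem lintegral_tsum_enorm_ne_top (hF : ∀ i, Integrable (F i) μ)
    (hs : Summable fun i => ∫ a, ‖F i a‖ ∂μ) : ∫⁻ a, ∑' i, ‖F i a‖ₑ ∂μ ≠ ∞ := by
  rw [lintegral_tsum fun i => (hF i).1.enorm]
  have h : ∀ i, ∫⁻ a, ‖F i a‖ₑ ∂μ = ENNReal.ofReal (∫ a, ‖F i a‖ ∂μ) := fun i =>
    (ofReal_integral_norm_eq_lintegral_enorm (hF i)).symm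
  simp only [h]
  exact hs.tsum_ofReal_ne_top

theorem ae_summable_of_summable_integral_norm (hF : ∀ i, Integrable (F i) μ)
    (hs : Summable fun i => ∫ a, ‖F i a‖ ∂μ) : ∀ᵐ a ∂μ, Summable fun i => F i a := by
  have h := ae_lt_top' (AEMeasurable.tsum fun i => (hF i).1.enorm)
    (lintegral_tsum_enorm_ne_top hF hs)
  filter_upwards [h] with a ha
  refine Summable.of_norm ?_
  have := ENNReal.summable_toReal ha.ne
  simpa using this

theorem integrable_tsum_of_summable_integral_norm (hF : ∀ i, Integrable (F i) μ)
    (hs : Summable fun i => ∫ a, ‖F i a‖ ∂μ) : Integrable (fun a => ∑' i, F i a) μ := by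
  refine ⟨?_, ?_⟩
  · refine aestronglyMeasurable_of_tendsto_ae Filter.atTop
      (f := fun (s : Finset ι) a => ∑ i ∈ s, F i a) (fun s => ?_) ?_
    · exact Finset.aestronglyMeasurable_fun_sum s fun i _ => (hF i).1
    · filter_upwards [ae_summable_of_summable_integral_norm hF hs] with a ha
      exact ha.hasSum
  · refine lt_of_le_of_lt (lintegral_mono fun a => enorm_tsum_le_tsum_enorm)
      (lintegral_tsum_enorm_ne_top hF hs).lt_top

end Series

/-! ### The logical state of a density operator -/

theorem integrable_codeAmplitude_mul_star (d : ℕ) (j k : ZMod d) (ψ : CVSpace) :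
    Integrable (fun z => codeAmplitude d j ψ z * star (codeAmplitude d k ψ z))
      (cellMeasure d) := by
  have h := L2.integrable_inner (𝕜 := ℂ) (codeAmplitude d k ψ) (codeAmplitude d j ψ)
  simp only [RCLike.inner_apply] at h
  exact h

theorem integrable_norm_sq_Lp {α : Type*} [MeasurableSpace α] {μ : Measure α} (f : Lp ℂ 2 μ) :
    Integrable (fun z => ‖f z‖ ^ 2) μ :=
  (memLp_two_iff_integrable_sq_norm (Lp.aestronglyMeasurable f)).1 (Lp.memLp f)

theorem integral_norm_sq_Lp {α : Type*} [MeasurableSpace α] {μ : Measure α} (f : Lp ℂ 2 μ) :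
    ∫ z, ‖f z‖ ^ 2 ∂μ = ‖f‖ ^ 2 := by
  have h := L2.inner_def (𝕜 := ℂ) f f
  simp only [inner_self_eq_norm_sq_to_K] at h
  have h2 : ∫ z, ((‖f z‖ ^ 2 : ℝ) : ℂ) ∂μ = ((‖f‖ ^ 2 : ℝ) : ℂ) := by
    push_cast
    exact h.symm
  rw [integral_complex_ofReal] at h2
  exact_mod_cast h2

theorem norm_codeAmplitude_sq_le (d : ℕ) [NeZero d] (j : ZMod d) (ψ : CVSpace) :
    ‖codeAmplitude d j ψ‖ ^ 2 ≤ ‖ψ‖ ^ 2 := by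
  rw [← sum_norm_sq_codeAmplitude d ψ]
  exact Finset.single_le_sum (f := fun j => ‖codeAmplitude d j ψ‖ ^ 2)
    (fun _ _ => sq_nonneg _) (Finset.mem_univ j)

theorem integral_norm_codeAmplitude_mul_star_le (d : ℕ) [NeZero d] (j k : ZMod d) (ψ : CVSpace) :
    ∫ z, ‖codeAmplitude d j ψ z * star (codeAmplitude d k ψ z)‖ ∂cellMeasure d ≤ ‖ψ‖ ^ 2 := by
  have hj := integrable_norm_sq_Lp (codeAmplitude d j ψ)
  have hk := integrable_norm_sq_Lp (codeAmplitude d k ψ)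
  calc ∫ z, ‖codeAmplitude d j ψ z * star (codeAmplitude d k ψ z)‖ ∂cellMeasure d
      ≤ ∫ z, (1 / 2) * (‖codeAmplitude d j ψ z‖ ^ 2 + ‖codeAmplitude d k ψ z‖ ^ 2)
          ∂cellMeasure d := by
        refine integral_mono (integrable_codeAmplitude_mul_star d j k ψ).norm
          ((hj.add hk).const_mul _) fun z => ?_
        simp only [norm_mul, norm_star]
        linarith [two_mul_le_add_sq ‖codeAmplitude d j ψ z‖ ‖codeAmplitude d k ψ z‖]
    _ ≤ ‖ψ‖ ^ 2 := by
        rw [integral_const_mul, integral_add hj hk, integral_norm_sq_Lp, integral_norm_sq_Lp]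
        linarith [norm_codeAmplitude_sq_le d j ψ, norm_codeAmplitude_sq_le d k ψ]

section DensityOperator

variable {d : ℕ} [NeZero d] {ρ : CVSpace →L[ℂ] CVSpace}

theorem logicalState_apply {d : ℕ} (z : ℝ × ℝ) (j k : ZMod d) :
    logicalState d ρ z j k = ∑' i, codeAmplitude d j (stateVec ρ i) z *
      star (codeAmplitude d k (stateVec ρ i) z) := rfl

theorem summable_integral_norm_codeAmplitude (hρ : IsDensityOperator ρ) (j k : ZMod d) :
    Summable fun i => ∫ z, ‖codeAmplitude d j (stateVec ρ i) z *
      star (codeAmplitude d k (stateVec ρ i) z)‖ ∂cellMeasure d :=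
  Summable.of_nonneg_of_le (fun _ => integral_nonneg fun _ => norm_nonneg _)
    (fun _ => integral_norm_codeAmplitude_mul_star_le d j k _) (hasSum_norm_sq_stateVec hρ).summable

theorem integrable_logicalState (hρ : IsDensityOperator ρ) (j k : ZMod d) :
    IntegrableOn (fun z => logicalState d ρ z j k) (syndromeCell d) :=
  integrable_tsum_of_summable_integral_norm
    (fun i => integrable_codeAmplitude_mul_star d j k (stateVec ρ i))
    (summable_integral_norm_codeAmplitude hρ j k)

theorem hasSum_setIntegral_torusChar_mul (hρ : IsDensityOperator ρ) (m n : ℤ) (j k : ZMod d) :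
    HasSum (fun i => ∫ z in syndromeCell d, torusChar d m n z *
        (codeAmplitude d j (stateVec ρ i) z * star (codeAmplitude d k (stateVec ρ i) z)))
      (∫ z in syndromeCell d, torusChar d m n z * logicalState d ρ z j k) := by
  have h := hasSum_integral_of_summable_integral_norm (μ := cellMeasure d)
    (F := fun i z => torusChar d m n z *
      (codeAmplitude d j (stateVec ρ i) z * star (codeAmplitude d k (stateVec ρ i) z)))
    (fun i => integrable_torusChar_mul m n (integrable_codeAmplitude_mul_star d j k _))
    ((summable_integral_norm_codeAmplitude hρ j k).congr fun i => by
      simp only [norm_mul, norm_torusChar, one_mul])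
  simp only [tsum_mul_left] at h
  exact h

theorem ae_summable_codeAmplitude (hρ : IsDensityOperator ρ) :
    ∀ᵐ z ∂cellMeasure d, ∀ j k, Summable fun i => codeAmplitude d j (stateVec ρ i) z *
      star (codeAmplitude d k (stateVec ρ i) z) := by
  rw [ae_all_iff]
  intro j
  rw [ae_all_iff]
  exact fun k => ae_summable_of_summable_integral_norm
    (fun i => integrable_codeAmplitude_mul_star d j k (stateVec ρ i))
    (summable_integral_norm_codeAmplitude hρ j k)

theorem ae_posSemidef_logicalState (hρ : IsDensityOperator ρ) :
    ∀ᵐ z ∂cellMeasure d, (logicalState d ρ z).PosSemidef := by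
  filter_upwards [ae_summable_codeAmplitude hρ] with z hz
  refine Matrix.PosSemidef.of_dotProduct_mulVec_nonneg ?_ fun x => ?_
  · ext j k
    rw [Matrix.conjTranspose_apply, logicalState_apply, logicalState_apply, tsum_star]
    refine tsum_congr fun i => ?_
    rw [star_mul', star_star, mul_comm]
  · have h : HasSum (fun i => ∑ j, star x j * ∑ k, codeAmplitude d j (stateVec ρ i) z *
        star (codeAmplitude d k (stateVec ρ i) z) * x k)
        (star x ⬝ᵥ (logicalState d ρ z).mulVec x) :=
      hasSum_sum fun j _ => (hasSum_sum fun k _ => (hz j k).hasSum.mul_right (x k)).mul_left _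
    refine h.nonneg fun i => ?_
    have e : ∑ j, star x j * ∑ k, codeAmplitude d j (stateVec ρ i) z *
        star (codeAmplitude d k (stateVec ρ i) z) * x k =
        (∑ j, star x j * codeAmplitude d j (stateVec ρ i) z) *
          star (∑ j, star x j * codeAmplitude d j (stateVec ρ i) z) := by
      rw [star_sum, Finset.sum_mul]
      refine Finset.sum_congr rfl fun j _ => ?_
      rw [Finset.mul_sum, Finset.mul_sum]
      refine Finset.sum_congr rfl fun k _ => ?_
      rw [star_mul', Pi.star_apply, Pi.star_apply, star_star]
      ring
    rw [e]
    exact mul_star_self_nonneg _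

theorem integrableOn_syndromeProb (hρ : IsDensityOperator ρ) :
    IntegrableOn (syndromeProb d ρ) (syndromeCell d) :=
  (integrable_finsetSum Finset.univ fun k _ => integrable_logicalState hρ k k).re

theorem setIntegral_syndromeProb (hρ : IsDensityOperator ρ) :
    ∫ z in syndromeCell d, syndromeProb d ρ z = 1 := by
  have h1 : ∀ k : ZMod d, HasSum (fun i => ((‖codeAmplitude d k (stateVec ρ i)‖ ^ 2 : ℝ) : ℂ))
      (∫ z in syndromeCell d, logicalState d ρ z k k) := by
    intro k
    refine (hasSum_integral_of_summable_integral_norm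
      (fun i => integrable_codeAmplitude_mul_star d k k (stateVec ρ i))
      (summable_integral_norm_codeAmplitude hρ k k)).congr_fun fun i => ?_
    rw [← integral_norm_sq_Lp, ← integral_complex_ofReal]
    refine integral_congr_ae (Filter.Eventually.of_forall fun z => ?_)
    simp only [Complex.star_def]
    rw [Complex.mul_conj, Complex.normSq_eq_norm_sq]
  have h2 := hasSum_sum fun (k : ZMod d) (_ : k ∈ Finset.univ) => h1 k
  have h3 : HasSum (fun i => ∑ k : ZMod d, ((‖codeAmplitude d k (stateVec ρ i)‖ ^ 2 : ℝ) : ℂ))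
      ((1 : ℝ) : ℂ) := by
    refine (Complex.hasSum_ofReal (f := fun i => ‖stateVec ρ i‖ ^ 2).2
      (hasSum_norm_sq_stateVec hρ)).congr_fun fun i => ?_
    rw [← Complex.ofReal_sum, sum_norm_sq_codeAmplitude]
  have h4 : ∫ z in syndromeCell d, (logicalState d ρ z).trace = ((1 : ℝ) : ℂ) := by
    rw [← h2.unique h3, ← integral_finsetSum _ fun k _ => integrable_logicalState hρ k k]
    rfl
  have h5 := (integral_re (𝕜 := ℂ) (μ := cellMeasure d)
    (f := fun z => (logicalState d ρ z).trace)
    (integrable_finsetSum Finset.univ fun k _ => integrable_logicalState hρ k k)).trans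
    (congrArg _ h4)
  exact h5

/-! ### The Zak–Gross Wigner function -/

/-- The Zak–Gross Wigner function: at `(s + a ℓ, t + b ℓ)` it is the Gross Wigner function at
`(a, b)` of the sub-normalised logical state with syndrome `(s, t)`. -/
def zakGrossWigner (d : ℕ) [NeZero d] (ρ : CVSpace →L[ℂ] CVSpace) : ℝ × ℝ → ℂ :=
  torusFun d fun a b z => grossWigner d (logicalState d ρ z) a b

theorem isZakGrossWigner_zakGrossWigner (hd : Odd d) (hρ : IsDensityOperator ρ) :
    IsZakGrossWigner d ρ (zakGrossWigner d ρ) where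
  integrable := integrableOn_torusFun fun a b =>
    integrableOn_grossWigner (integrable_logicalState hρ) a b
  fourierCoeff_eq m n := by
    have h := setIntegral_torusChar_mul_torusFun hd (integrable_logicalState (d := d) hρ) m n
    have h1 : HasSum (fun i => ZMod.stdAddChar (-((m : ZMod d) * (n : ZMod d))) *
        (latticePhase d m n)⁻¹ *
        inner ℂ (stateVec ρ i) (displacement (n * step d) (m * step d) (stateVec ρ i)))
        (∑ k : ZMod d, ZMod.stdAddChar ((m : ZMod d) * k) *
          ∫ z in syndromeCell d, torusChar d m n z * logicalState d ρ z k (k + n)) := by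
      refine (hasSum_sum fun (k : ZMod d) (_ : k ∈ Finset.univ) =>
        (hasSum_setIntegral_torusChar_mul hρ m n k (k + n)).mul_left
          (ZMod.stdAddChar ((m : ZMod d) * k) : ℂ)).congr_fun fun i => ?_
      exact (sum_setIntegral_codeAmplitude (stateVec ρ i) m n).symm
    have h2 := h1.tsum_eq
    rw [tsum_mul_left, ← opTrace_mul_eq_tsum hρ] at h2
    rw [← h2] at h
    have hd0 : (d : ℂ) ≠ 0 := Nat.cast_ne_zero.2 (NeZero.ne d)
    have hpi : ((2 * Real.pi : ℝ) : ℂ) ≠ 0 := Complex.ofReal_ne_zero.2 Real.two_pi_pos.ne'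
    have hs : ((1 / (d * step d) ^ 2 : ℝ) : ℂ) * d = ((1 / (2 * Real.pi) : ℝ) : ℂ) := by
      have e : (d * step d) ^ 2 = d * (2 * Real.pi) := by rw [← mul_step_sq d]; ring
      rw [e]
      push_cast at hpi ⊢
      field_simp
    change ((1 / (d * step d) ^ 2 : ℝ) : ℂ) * ∫ z in phaseTorus d,
      torusChar d m n z * torusFun d (fun a b z => grossWigner d (logicalState d ρ z) a b) z = _
    rw [h, ← stdAddChar_halfMod_mul_phase hd, ← hs]
    ring

/-- The Fourier coefficients determine the Zak–Gross Wigner function almost everywhere. -/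
theorem IsZakGrossWigner.ae_eq {W V : ℝ × ℝ → ℂ} (hW : IsZakGrossWigner d ρ W)
    (hV : IsZakGrossWigner d ρ V) : W =ᵐ[volume.restrict (phaseTorus d)] V := by
  have hL : ((1 / (d * step d) ^ 2 : ℝ) : ℂ) ≠ 0 :=
    Complex.ofReal_ne_zero.2 (one_div_pos.2 (pow_pos (mul_step_pos d) 2)).ne'
  have h : W - V =ᵐ[volume.restrict (phaseTorus d)] 0 := by
    refine ae_eq_zero_of_fourier (hW.integrable.sub hV.integrable) fun m n => ?_
    have e := mul_left_cancel₀ hL ((hW.fourierCoeff_eq m n).trans (hV.fourierCoeff_eq m n).symm)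
    simp only [Pi.sub_apply, mul_sub]
    rw [integral_sub (integrable_torusChar_mul m n hW.integrable)
      (integrable_torusChar_mul m n hV.integrable)]
    exact sub_eq_zero.2 e
  filter_upwards [h] with z hz
  exact sub_eq_zero.1 hz

/-! ### Negative volumes -/

theorem integrableOn_grossNegVolume_logicalState (hρ : IsDensityOperator ρ) :
    IntegrableOn (fun z => grossNegVolume d (logicalState d ρ z)) (syndromeCell d) :=
  (integrable_finsetSum _ fun a _ => integrable_finsetSum _ fun b _ =>
    (integrableOn_grossWigner (integrable_logicalState hρ) a b).norm).const_mul _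

theorem torusNegVolume_zakGrossWigner (hρ : IsDensityOperator ρ) :
    torusNegVolume d (zakGrossWigner d ρ) =
      ∫ z in syndromeCell d, grossNegVolume d (logicalState d ρ z) := by
  have hi : ∀ a b : ZMod d, IntegrableOn
      (fun z => ‖grossWigner d (logicalState d ρ z) a b‖) (syndromeCell d) := fun a b =>
    (integrableOn_grossWigner (integrable_logicalState hρ) a b).norm
  have hpt : ∀ a b : ZMod d, EqOn (fun z => 1 / (d : ℝ) *
      ‖zakGrossWigner d ρ (z + cellCorner d (a, b))‖)
      (fun z => 1 / (d : ℝ) * ‖grossWigner d (logicalState d ρ z) a b‖) (syndromeCell d) := by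
    intro a b z hz
    simp only [zakGrossWigner]
    rw [torusFun_add_cellCorner d _ a b hz]
  rw [torusNegVolume, setIntegral_phaseTorus]
  · rw [Finset.sum_congr rfl fun a _ => Finset.sum_congr rfl fun b _ =>
      setIntegral_congr_fun (measurableSet_syndromeCell d) (hpt a b)]
    simp only [grossNegVolume, integral_const_mul]
    rw [integral_finsetSum _ fun a _ => integrable_finsetSum _ fun b _ => hi a b, Finset.mul_sum]
    refine Finset.sum_congr rfl fun a _ => ?_
    rw [integral_finsetSum _ fun b _ => hi a b, Finset.mul_sum]
  · rintro ⟨a, b⟩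
    exact IntegrableOn.congr_fun ((hi a b).const_mul _) (fun z hz => (hpt a b hz).symm)
      (measurableSet_syndromeCell d)

theorem grossNegVolume_smul (c : ℂ) (M : Matrix (ZMod d) (ZMod d) ℂ) :
    grossNegVolume d (c • M) = ‖c‖ * grossNegVolume d M := by
  simp only [grossNegVolume, grossWigner_smul, norm_mul, ← Finset.mul_sum]
  ring

theorem trace_logicalState {z : ℝ × ℝ} (hz : (logicalState d ρ z).PosSemidef) :
    0 ≤ syndromeProb d ρ z ∧ (logicalState d ρ z).trace = syndromeProb d ρ z := by
  have h := Complex.nonneg_iff.1 hz.trace_nonneg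
  exact ⟨h.1, Complex.ext rfl (by rw [Complex.ofReal_im, ← h.2])⟩

theorem logicalState_eq_zero {z : ℝ × ℝ} (hz : (logicalState d ρ z).PosSemidef)
    (h0 : syndromeProb d ρ z = 0) : logicalState d ρ z = 0 := by
  refine hz.trace_eq_zero_iff.1 ?_
  rw [(trace_logicalState hz).2, h0, Complex.ofReal_zero]

/-- Normalisation is undone by the weight, also where the density, and with it the sub-normalised
state, vanishes. -/
theorem syndromeProb_mul_grossNegVolume {z : ℝ × ℝ} (hz : (logicalState d ρ z).PosSemidef) :
    syndromeProb d ρ z * grossNegVolume d (normalizedLogicalState d ρ z) =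
      grossNegVolume d (logicalState d ρ z) := by
  by_cases h0 : syndromeProb d ρ z = 0
  · rw [logicalState_eq_zero hz h0, h0, zero_mul]
    simp [grossNegVolume, grossWigner]
  · rw [normalizedLogicalState, grossNegVolume_smul, norm_inv, Complex.norm_real,
      Real.norm_of_nonneg (trace_logicalState hz).1, mul_inv_cancel_left₀ h0]

theorem grossNegVolume_sub_re_trace (hd : Odd d) (M : Matrix (ZMod d) (ZMod d) ℂ) :
    grossNegVolume d M - M.trace.re =
      1 / d * ∑ a : ZMod d, ∑ b : ZMod d, (‖grossWigner d M a b‖ - (grossWigner d M a b).re) := by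
  have hd0 : (d : ℝ) ≠ 0 := Nat.cast_ne_zero.2 (NeZero.ne d)
  have h := congrArg Complex.re (sum_grossWigner d hd M)
  simp only [Complex.re_sum, Complex.mul_re, Complex.natCast_re, Complex.natCast_im, zero_mul,
    sub_zero] at h
  simp only [Finset.sum_sub_distrib, h, grossNegVolume]
  field_simp

theorem re_trace_le_grossNegVolume (hd : Odd d) (M : Matrix (ZMod d) (ZMod d) ℂ) :
    M.trace.re ≤ grossNegVolume d M := by
  rw [← sub_nonneg, grossNegVolume_sub_re_trace hd]
  exact mul_nonneg (by positivity) (Finset.sum_nonneg fun a _ => Finset.sum_nonneg fun b _ =>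
    sub_nonneg.2 (Complex.re_le_norm _))

theorem norm_sub_re_eq_zero_iff (w : ℂ) : ‖w‖ - w.re = 0 ↔ 0 ≤ w := by
  rw [sub_eq_zero, eq_comm, Complex.re_eq_norm]

theorem grossNegVolume_eq_re_trace_iff (hd : Odd d) (M : Matrix (ZMod d) (ZMod d) ℂ) :
    grossNegVolume d M = M.trace.re ↔ ∀ a b, 0 ≤ grossWigner d M a b := by
  have hd0 : (1 / d : ℝ) ≠ 0 := one_div_ne_zero (Nat.cast_ne_zero.2 (NeZero.ne d))
  have hn : ∀ a b, 0 ≤ ‖grossWigner d M a b‖ - (grossWigner d M a b).re := fun a b =>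
    sub_nonneg.2 (Complex.re_le_norm _)
  rw [← sub_eq_zero, grossNegVolume_sub_re_trace hd, mul_eq_zero, or_iff_right hd0,
    Finset.sum_eq_zero_iff_of_nonneg fun a _ => Finset.sum_nonneg fun b _ => hn a b]
  simp only [Finset.sum_eq_zero_iff_of_nonneg fun b _ => hn _ b, Finset.mem_univ, true_imp_iff,
    norm_sub_re_eq_zero_iff]

/-- Where the syndrome density vanishes both sides hold, since the sub-normalised state is zero. -/
theorem syndromeProb_eq_grossNegVolume_iff (hd : Odd d) {z : ℝ × ℝ}
    (hz : (logicalState d ρ z).PosSemidef) :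
    syndromeProb d ρ z = grossNegVolume d (logicalState d ρ z) ↔
      (0 < syndromeProb d ρ z →
        ∀ a b : ZMod d, 0 ≤ grossWigner d (normalizedLogicalState d ρ z) a b) := by
  rw [eq_comm, syndromeProb, grossNegVolume_eq_re_trace_iff hd, ← syndromeProb]
  rcases (trace_logicalState hz).1.eq_or_lt with h0 | h0
  · rw [← h0, logicalState_eq_zero hz h0.symm]
    simp [grossWigner]
  · have hc : (0 : ℂ) < syndromeProb d ρ z := by exact_mod_cast h0
    have hc' : (0 : ℂ) ≤ (syndromeProb d ρ z : ℂ)⁻¹ := by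
      rw [← Complex.ofReal_inv]
      exact_mod_cast (inv_pos.2 h0).le
    simp only [h0, true_imp_iff, normalizedLogicalState, grossWigner_smul]
    refine forall_congr' fun a => forall_congr' fun b => ⟨mul_nonneg hc', fun h => ?_⟩
    have h2 := mul_nonneg hc.le h
    rwa [mul_inv_cancel_left₀ hc.ne'] at h2

end DensityOperator

end

theorem corollary1 (d : ℕ) [NeZero d] (hd : Odd d)
    (ρ : CVSpace →L[ℂ] CVSpace) (hρ : IsDensityOperator ρ) :
    -- the syndrome distribution is a probability density, and the post-measurement
    -- logical states are genuine qudit states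
    (∀ᵐ z ∂(volume.restrict (syndromeCell d)), (logicalState d ρ z).PosSemidef) ∧
    IntegrableOn (syndromeProb d ρ) (syndromeCell d) ∧
    ∫ z in syndromeCell d, syndromeProb d ρ z = 1 ∧
    IntegrableOn (fun z => syndromeProb d ρ z * grossNegVolume d (normalizedLogicalState d ρ z))
      (syndromeCell d) ∧
    -- the Zak--Gross Wigner function exists
    (∃ W : ℝ × ℝ → ℂ, IsZakGrossWigner d ρ W) ∧
    ∀ W : ℝ × ℝ → ℂ, IsZakGrossWigner d ρ W →
      -- its negative volume is the average of the discrete negative volume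
      torusNegVolume d W =
        ∫ z in syndromeCell d,
          syndromeProb d ρ z * grossNegVolume d (normalizedLogicalState d ρ z) ∧
      -- hence it detects the negativity of the error-corrected logical states
      1 ≤ torusNegVolume d W ∧
      (torusNegVolume d W = 1 ↔
        ∀ᵐ z ∂(volume.restrict (syndromeCell d)), 0 < syndromeProb d ρ z →
          ∀ a b : ZMod d, 0 ≤ grossWigner d (normalizedLogicalState d ρ z) a b) := by
  have hpos := ae_posSemidef_logicalState (d := d) hρ
  have hZ := isZakGrossWigner_zakGrossWigner hd hρ
  have hPr := integrableOn_syndromeProb (d := d) hρ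
  have hN := integrableOn_grossNegVolume_logicalState (d := d) hρ
  have hae : (fun z => grossNegVolume d (logicalState d ρ z)) =ᵐ[volume.restrict (syndromeCell d)]
      fun z => syndromeProb d ρ z * grossNegVolume d (normalizedLogicalState d ρ z) := by
    filter_upwards [hpos] with z hz
    exact (syndromeProb_mul_grossNegVolume hz).symm
  have hle : syndromeProb d ρ ≤ fun z => grossNegVolume d (logicalState d ρ z) := fun z =>
    re_trace_le_grossNegVolume hd _
  refine ⟨hpos, hPr, setIntegral_syndromeProb hρ, hN.congr hae, ⟨_, hZ⟩, fun W hW => ?_⟩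
  have hvol : torusNegVolume d W =
      ∫ z in syndromeCell d, grossNegVolume d (logicalState d ρ z) := by
    rw [← torusNegVolume_zakGrossWigner hρ, torusNegVolume, torusNegVolume]
    refine integral_congr_ae ?_
    filter_upwards [hW.ae_eq hZ] with z hz
    rw [hz]
  refine ⟨hvol.trans (integral_congr_ae hae), ?_, ?_⟩
  · rw [hvol, ← setIntegral_syndromeProb (d := d) hρ]
    exact integral_mono hPr hN hle
  · rw [hvol, ← setIntegral_syndromeProb (d := d) hρ, eq_comm,
      integral_eq_iff_of_ae_le hPr hN (Filter.Eventually.of_forall hle)]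
    refine ⟨fun h => ?_, fun h => ?_⟩
    · filter_upwards [h, hpos] with z h1 hz
      exact (syndromeProb_eq_grossNegVolume_iff hd hz).1 h1
    · filter_upwards [h, hpos] with z h1 hz
      exact (syndromeProb_eq_grossNegVolume_iff hd hz).2 h1
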